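/- Let $d$ be a positive integer, let $c\in\{1,2,\dots\}\cup\{\infty\}$, and let $x_0\in\mathbb Z_{\ge 0}^d$ satisfy $x_{0,1}<\dots<x_{0,d}$. **SBBS.** The $d$-ball stochastic box-ball system (SBBS) with capacity $c$ and error probability $\varepsilon\in(0,1)$, started from $x_0$, is the following discrete-time process on configurations of $d$ balls on the sites $\mathbb Z_{\ge 0}$ (at most one ball per site). At time $0$ the balls are at the sites $x_{0,1},\dots,x_{0,d}$. In each time step a carrier, initially empty, visits the sites from left to right: at a site with a ball, if it carries fewer than $c$ balls, it picks up the ball with probability $1-\varepsilon$, independently for each ball and each time step, and otherwise it leaves the ball there; at an empty site, if it carries at least one ball, it drops one ball there. The configuration after the whole sweep is the configuration at the next time. For $t\ge 0$ let $\zeta^\varepsilon(t)=(\zeta^\varepsilon_1(t),\dots,\zeta^\varepsilon_d(t))$, with $\zeta^\varepsilon_1(t)<\dots<\zeta^\varepsilon_d(t)$, be the positions of the $d$ balls at time $\lfloor t/(1-\varepsilon)\rfloor$, listed from left to right. **PushTASEP.** The $d$-particle PushTASEP started from $x_0$ is the continuous-time càdlàg process of $d$ particles on $\mathbb Z_{\ge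 0}$, at most one per site, in which the particles start at $x_0$ and carry independent exponential clocks of rate $1$. When the clock of a particle rings, the particle jumps one site to the right; if that site is occupied, the particle there is pushed one site to the right, in turn pushing any particle immediately to its right, and so on. Nothing else moves. **Theorem.** As $\varepsilon\nearrow 1$, the processes $\zeta^\varepsilon$ converge weakly, in the Skorokhod space $D([0,\infty),\mathbb Z_{\ge 0}^d)$ with the $J_1$ topology, to the $d$-particle PushTASEP started from $x_0$. -/

import Mathlib

open MeasureTheory ProbabilityTheory Filter Topology
open scoped NNReal ENNReal

/-! ## Càdlàg paths and the Skorokhod topology -/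

/-- The space `D([0, ∞), E)` of right-continuous paths in `E` with left limits. -/
structure CadlagPath (E : Type*) [TopologicalSpace E] where
  /-- The underlying function of time. -/
  toFun : ℝ≥0 → E
  right_continuous : ∀ t, ContinuousWithinAt toFun (Set.Ici t) t
  left_limit : ∀ t, ∃ y, Tendsto toFun (𝓝[<] t) (𝓝 y)

namespace CadlagPath

instance {E : Type*} [TopologicalSpace E] : CoeFun (CadlagPath E) (fun _ => ℝ≥0 → E) :=
  ⟨CadlagPath.toFun⟩

/-- Basic Skorokhod (J1) neighbourhood of the path `x`: the paths `y` for which there is a time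
change (an increasing bijection of `[0, ∞)`) that differs by less than `δ` from the identity on
`[0, T]` and after which `y` differs by less than `δ` from `x` on `[0, T]`. -/
def skorokhodNhd {E : Type*} [PseudoMetricSpace E] (x : CadlagPath E) (T : ℝ≥0) (δ : ℝ) :
    Set (CadlagPath E) :=
  {y | ∃ lam : ℝ≥0 ≃o ℝ≥0, ∀ t ≤ T, dist (lam t) t < δ ∧ dist (x t) (y (lam t)) < δ}

/-- The neighbourhoods shrink as `T` grows and `δ` decreases. -/
theorem skorokhodNhd_subset {E : Type*} [PseudoMetricSpace E] (x : CadlagPath E)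
    {T T' : ℝ≥0} {δ δ' : ℝ} (hT : T ≤ T') (hδ : δ' ≤ δ) :
    skorokhodNhd x T' δ' ⊆ skorokhodNhd x T δ := by
  rintro y ⟨lam, h⟩
  exact ⟨lam, fun t ht => ⟨(h t (ht.trans hT)).1.trans_le hδ, (h t (ht.trans hT)).2.trans_le hδ⟩⟩

/-- The Skorokhod (J1) topology on `D([0, ∞), E)`. -/
instance {E : Type*} [PseudoMetricSpace E] : TopologicalSpace (CadlagPath E) where
  IsOpen U := ∀ x ∈ U, ∃ T : ℝ≥0, ∃ δ > 0, skorokhodNhd x T δ ⊆ U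
  isOpen_univ := fun _ _ => ⟨0, 1, one_pos, Set.subset_univ _⟩
  isOpen_inter := by
    rintro U V hU hV x ⟨hxU, hxV⟩
    obtain ⟨T, δ, hδ, h⟩ := hU x hxU
    obtain ⟨T', δ', hδ', h'⟩ := hV x hxV
    exact ⟨max T T', min δ δ', lt_min hδ hδ', Set.subset_inter
      ((skorokhodNhd_subset x (le_max_left _ _) (min_le_left _ _)).trans h)
      ((skorokhodNhd_subset x (le_max_right _ _) (min_le_right _ _)).trans h')⟩
  isOpen_sUnion := by
    rintro S hS x ⟨U, hU, hxU⟩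
    obtain ⟨T, δ, hδ, h⟩ := hS U hU x hxU
    exact ⟨T, δ, hδ, h.trans (Set.subset_sUnion_of_mem hU)⟩

/-- The path space carries its Borel sigma-algebra. -/
instance {E : Type*} [PseudoMetricSpace E] : MeasurableSpace (CadlagPath E) :=
  borel (CadlagPath E)

instance {E : Type*} [PseudoMetricSpace E] : BorelSpace (CadlagPath E) := ⟨rfl⟩

end CadlagPath

/-! ## The stochastic box-ball system -/

/-- Number of balls in the capacity-`c` carrier after it has scanned the first `k` sites
`0, …, k - 1` of the configuration `ζ` (`ζ k = true` means that site `k` holds a ball), where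
`a k = true` means that the carrier does not fail to pick up a ball at site `k`. -/
def carrier (c : ℕ∞) (ζ a : ℕ → Bool) : ℕ → ℕ
  | 0 => 0
  | k + 1 =>
    let g := carrier c ζ a k
    if ζ k = true ∧ (g : ℕ∞) < c ∧ a k = true then g + 1
    else if ζ k = false ∧ 1 ≤ g then g - 1
    else g

/-- The configuration after one sweep of the carrier: a site holds a ball iff the carrier dropped
a ball there, or there was a ball that the carrier did not pick up. -/
def sweep (c : ℕ∞) (ζ a : ℕ → Bool) : ℕ → Bool := fun k =>
  decide (carrier c ζ a (k + 1) + 1 = carrier c ζ a k ∨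
    (carrier c ζ a (k + 1) = carrier c ζ a k ∧ ζ k = true))

/-- The configuration with balls exactly at the positions `x i`. -/
def configOf {d : ℕ} (x : Fin d → ℕ) : ℕ → Bool := fun k => decide (∃ i, x i = k)

/-- The positions of the `d` balls of a configuration, from left to right. -/
noncomputable def ballPositions (d : ℕ) (ζ : ℕ → Bool) : Fin d → ℕ := fun i =>
  Nat.nth (fun k => ζ k = true) i

/-- The pick-up outcomes by site, when the `i`-th ball from the left has the coin `coin i`. -/
def siteOutcome {d : ℕ} (x : Fin d → ℕ) (coin : Fin d → Bool) : ℕ → Bool := fun k =>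
  decide (∃ i, x i = k ∧ coin i = true)

/-- The `d`-ball box-ball trajectory of capacity `c` started from balls at the positions `x₀`,
where `coin s i` tells whether the carrier does not fail at the `i`-th ball from the left in the
sweep from time `s` to time `s + 1`. -/
noncomputable def sbbs {d : ℕ} (c : ℕ∞) (x₀ : Fin d → ℕ) (coin : ℕ → Fin d → Bool) :
    ℕ → (ℕ → Bool)
  | 0 => configOf x₀
  | s + 1 =>
    let ζ := sbbs c x₀ coin s
    sweep c ζ (siteOutcome (ballPositions d ζ) (coin s))

/-- The coin flips of a `d`-ball stochastic box-ball system with error probability `ε`: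
independent, and each one fails with probability `ε`. -/
structure IsSBBSCoins {Ω : Type*} [MeasurableSpace Ω] (P : Measure Ω) (d : ℕ) (ε : ℝ)
    (coin : ℕ → Fin d → Ω → Bool) : Prop where
  measurable : ∀ s i, Measurable (coin s i)
  indep : iIndepFun (fun p : ℕ × Fin d => coin p.1 p.2) P
  success : ∀ s i, P {ω | coin s i ω = true} = ENNReal.ofReal (1 - ε)
  failure : ∀ s i, P {ω | coin s i ω = false} = ENNReal.ofReal ε

/-- The path that has the value `f ⌊t / (1 - ε)⌋` at time `t`. -/
noncomputable def floorPath {E : Type*} [TopologicalSpace E] (ε : Set.Ioo (0 : ℝ) 1) (f : ℕ → E) :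
    CadlagPath E where
  toFun t := f ⌊(t : ℝ) / (1 - (ε : ℝ))⌋₊
  right_continuous t := by
    have hb : 0 < 1 - (ε : ℝ) := by linarith [ε.2.2]
    have hlt : (t : ℝ) / (1 - (ε : ℝ)) < ⌊(t : ℝ) / (1 - (ε : ℝ))⌋₊ + 1 := Nat.lt_floor_add_one _
    have hc : Continuous fun s : ℝ≥0 => (s : ℝ) / (1 - (ε : ℝ)) := by fun_prop
    refine tendsto_const_nhds.congr' ?_
    filter_upwards [mem_nhdsWithin_of_mem_nhds (hc.continuousAt.eventually_lt_const hlt),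
      self_mem_nhdsWithin] with s hs hts
    have hts' : (t : ℝ) ≤ s := by exact_mod_cast hts
    congr 1
    refine ((Nat.floor_eq_iff (by positivity)).2 ⟨?_, hs⟩).symm
    exact (Nat.floor_le (by positivity)).trans (by gcongr)
  left_limit t := by
    have hb : 0 < 1 - (ε : ℝ) := by linarith [ε.2.2]
    have hc : Continuous fun s : ℝ≥0 => (s : ℝ) / (1 - (ε : ℝ)) := by fun_prop
    refine ⟨f (⌈(t : ℝ) / (1 - (ε : ℝ))⌉₊ - 1), tendsto_const_nhds.congr' ?_⟩
    rcases eq_or_ne t 0 with h0 | h0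
    · subst h0
      have : (𝓝[<] (0 : ℝ≥0)) = ⊥ := by simp
      rw [this]
      trivial
    · have hpos : 0 < (t : ℝ) / (1 - (ε : ℝ)) :=
        div_pos (NNReal.coe_pos.2 (pos_iff_ne_zero.2 h0)) hb
      have hn : 0 < ⌈(t : ℝ) / (1 - (ε : ℝ))⌉₊ := Nat.ceil_pos.2 hpos
      have hlt : ((⌈(t : ℝ) / (1 - (ε : ℝ))⌉₊ - 1 : ℕ) : ℝ) < (t : ℝ) / (1 - (ε : ℝ)) :=
        Nat.lt_ceil.1 (by omega)
      filter_upwards [mem_nhdsWithin_of_mem_nhds (hc.continuousAt.eventually_const_lt hlt),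
        self_mem_nhdsWithin] with s hs hst
      have hst' : (s : ℝ) < t := by exact_mod_cast hst
      congr 1
      refine ((Nat.floor_eq_iff (by positivity)).2 ⟨hs.le, ?_⟩).symm
      have h1 : (s : ℝ) / (1 - (ε : ℝ)) < (t : ℝ) / (1 - (ε : ℝ)) := by gcongr
      have h2 := Nat.le_ceil ((t : ℝ) / (1 - (ε : ℝ)))
      have h3 : (((⌈(t : ℝ) / (1 - (ε : ℝ))⌉₊ - 1 : ℕ) : ℝ)) + 1
          = (⌈(t : ℝ) / (1 - (ε : ℝ))⌉₊ : ℝ) := by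
        exact_mod_cast Nat.sub_add_cancel hn
      linarith

/-- The rescaled ball-position process `ζ^ε`: at time `t`, the positions of the `d` balls of the
stochastic box-ball system at time `⌊t / (1 - ε)⌋`. -/
noncomputable def sbbsProcess {Ω : Type*} {d : ℕ} (c : ℕ∞) (x₀ : Fin d → ℕ)
    (ε : Set.Ioo (0 : ℝ) 1) (coin : ℕ → Fin d → Ω → Bool) (ω : Ω) : CadlagPath (Fin d → ℕ) :=
  floorPath ε fun n => ballPositions d (sbbs c x₀ (fun s i => coin s i ω) n)

/-! ## PushTASEP -/

/-- The configuration after particle `i` has jumped one site to the right and pushed the particles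
in front of it: the particles that move are those at a site `m ≥ x i` such that all the sites
from `x i` to `m` are occupied. -/
def push {d : ℕ} (i : Fin d) (x : Fin d → ℕ) : Fin d → ℕ := fun j =>
  if x i ≤ x j ∧ ∀ m ∈ Finset.Icc (x i) (x j), ∃ l, x l = m then x j + 1 else x j

/-- The clock of particle `i` with waiting times `τ i 0, τ i 1, …` rings at time `t`. -/
def RingsAt {d : ℕ} (τ : Fin d → ℕ → ℝ) (i : Fin d) (t : ℝ) : Prop :=
  ∃ n, ∑ k ∈ Finset.range (n + 1), τ i k = t

/-- `X` is the `d`-particle PushTASEP started from `x₀`: the particles carry independent clocks with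
independent rate-one exponential waiting times; almost surely, when the clock of particle `i` rings,
particle `i` jumps one site to the right and pushes the particles in front of it, and nothing moves
at other times. -/
def IsPushTASEP {Ω : Type*} [MeasurableSpace Ω] (P : Measure Ω) {d : ℕ} (x₀ : Fin d → ℕ)
    (X : Ω → CadlagPath (Fin d → ℕ)) : Prop :=
  ∃ τ : Fin d → ℕ → Ω → ℝ,
    (∀ i n, HasLaw (τ i n) (expMeasure 1) P) ∧
    iIndepFun (fun p : Fin d × ℕ => τ p.1 p.2) P ∧
    ∀ᵐ ω ∂P, X ω 0 = x₀ ∧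
      ∀ t : ℝ≥0, 0 < t → ∀ y : Fin d → ℕ, Tendsto (X ω) (𝓝[<] t) (𝓝 y) →
        (∀ i, RingsAt (fun j n => τ j n ω) i t → X ω t = push i y) ∧
        ((∀ i, ¬ RingsAt (fun j n => τ j n ω) i t) → X ω t = y)

/-! ## One sweep of the carrier -/

/-! In a sweep with no successful coin nothing moves. In a sweep with exactly one, the carrier takes
that ball to the first empty site beyond it, which on configurations is a PushTASEP push
(`sweep_of_single_success`). The carrier then never holds more than one ball, so the capacity plays
no role. As `ε` tends to 1, successes in the same sweep disappear on bounded rescaled time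
intervals, because distinct exponential clocks almost surely never ring together.

This is made exact by a coupling on the space of the PushTASEP. Each waiting time `τ` is replaced by
`⌈τ / -log ε⌉`, which is geometric, so marking the resulting renewal times gives independent coins
with success probability `1 - ε` (`map_coins_eq_map_renewalCoins`). After multiplication by `1 - ε`
the renewal times converge pointwise to the ring times (`tendsto_rescaled_ceil`).

The rest is deterministic. Both processes are read off from their ring times through `Reaches`,
which uses only the order of these times. A small time change matches the finitely many relevant
rings (`exists_timeChange`), after which the two paths coincide exactly on `[0, T]`; this gives J1
convergence (`tendsto_of_isDrivenBy`). Almost sure convergence of the coupled paths and dominated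
convergence then give weak convergence.

`Reaches` reaches no state once two rings coincide. Hence `IsDrivenBy` says nothing about sweeps
with several successes, and these need never be analysed. -/

theorem push_strictMono {d : ℕ} (i : Fin d) {x : Fin d → ℕ} (hx : StrictMono x) :
    StrictMono (push i x) := by
  intro j k hjk
  have h := hx hjk
  unfold push
  split_ifs with h1 h2 h2
  · omega
  · rcases (Nat.succ_le_of_lt h).lt_or_eq with h3 | h3
    · exact h3
    · refine absurd ⟨h1.1.trans h.le, fun m hm => ?_⟩ h2
      rw [Finset.mem_Icc] at hm
      rcases Nat.lt_or_ge (x j) m with h4 | h4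
      · exact ⟨k, by omega⟩
      · exact h1.2 m (Finset.mem_Icc.2 ⟨hm.1, h4⟩)
  · omega
  · exact h

theorem ballPositions_configOf {d : ℕ} {x : Fin d → ℕ} (hx : StrictMono x) :
    ballPositions d (configOf x) = x := by
  funext i
  have hcount : Nat.count (fun k => configOf x k = true) (x i) = i := by
    rw [Nat.count_eq_card_filter_range]
    have : (Finset.range (x i)).filter (fun k => configOf x k = true)
        = (Finset.Iio i).image x := by
      ext k
      simp only [Finset.mem_filter, Finset.mem_range, configOf, decide_eq_true_eq,
        Finset.mem_image, Finset.mem_Iio]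
      constructor
      · rintro ⟨hk, j, rfl⟩
        exact ⟨j, hx.lt_iff_lt.1 hk, rfl⟩
      · rintro ⟨j, hj, rfl⟩
        exact ⟨hx hj, j, rfl⟩
    rw [this, Finset.card_image_of_injective _ hx.injective, Fin.card_Iio]
  have := Nat.nth_count (p := fun k => configOf x k = true) (n := x i)
    (by simp [configOf])
  rw [hcount] at this
  exact this

theorem carrier_of_no_success (c : ℕ∞) (ζ : ℕ → Bool) (k : ℕ) :
    carrier c ζ (fun _ => false) k = 0 := by
  induction k with
  | zero => rfl
  | succ k ih => simp [carrier, ih]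

theorem sweep_of_no_success (c : ℕ∞) (ζ : ℕ → Bool) : sweep c ζ (fun _ => false) = ζ := by
  funext k
  simp [sweep, carrier_of_no_success]

theorem sbbs_succ_of_no_success {d : ℕ} (c : ℕ∞) (x₀ : Fin d → ℕ) (coin : ℕ → Fin d → Bool)
    (s : ℕ) (h : ∀ i, coin s i = false) : sbbs c x₀ coin (s + 1) = sbbs c x₀ coin s := by
  have : siteOutcome (ballPositions d (sbbs c x₀ coin s)) (coin s) = fun _ => false := by
    funext k
    simp [siteOutcome, h]
  change sweep c _ (siteOutcome (ballPositions d (sbbs c x₀ coin s)) (coin s)) = _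
  rw [this, sweep_of_no_success]

theorem exists_first_empty {d : ℕ} (x : Fin d → ℕ) (i : Fin d) :
    ∃ e, x i < e ∧ (∀ l, x l ≠ e) ∧ ∀ m, x i ≤ m → m < e → ∃ l, x l = m := by
  classical
  have hex : ∃ m, x i ≤ m ∧ ∀ l, x l ≠ m := by
    -- This site lies beyond every particle.
    refine ⟨(∑ l, x l) + 1, ?_, fun l => ?_⟩
    · exact (Finset.single_le_sum (f := x) (fun _ _ => Nat.zero_le _) (Finset.mem_univ i)).trans
        (Nat.le_succ _)
    · have := Finset.single_le_sum (f := x) (fun _ _ => Nat.zero_le _) (Finset.mem_univ l)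
      omega
  refine ⟨Nat.find hex, ?_, (Nat.find_spec hex).2, fun m hm hlt => ?_⟩
  · exact lt_of_le_of_ne (Nat.find_spec hex).1 ((Nat.find_spec hex).2 i)
  · have := Nat.find_min hex hlt
    push Not at this
    exact this hm

/-- The only pick-up is at `x i`; the occupied sites up to `e` leave no room to drop, so the load is
one until `e` and zero afterwards. -/
theorem carrier_of_single_success {d : ℕ} {c : ℕ∞} (hc : 1 ≤ c) {x : Fin d → ℕ} (i : Fin d)
    {e : ℕ} (hlt : x i < e) (hemp : ∀ l, x l ≠ e)
    (hocc : ∀ m, x i ≤ m → m < e → ∃ l, x l = m) (k : ℕ) :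
    carrier c (configOf x) (fun k => decide (k = x i)) k
      = if x i < k ∧ k ≤ e then 1 else 0 := by
  induction k with
  | zero => simp [carrier]
  | succ k ih =>
    have hcpos : (0 : ℕ∞) < c := lt_of_lt_of_le zero_lt_one hc
    simp only [carrier, ih, configOf, decide_eq_true_eq, decide_eq_false_iff_not]
    rcases lt_trichotomy k (x i) with h | h | h
    · have h1 : ¬ (x i < k ∧ k ≤ e) := by omega
      have h2 : ¬ (x i < k + 1 ∧ k + 1 ≤ e) := by omega
      rw [if_neg h1, if_neg h2]
      simp [h.ne]
    · subst h
      have h2 : x i < x i + 1 ∧ x i + 1 ≤ e := by omega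
      simp [hcpos, hlt]
    · rcases lt_trichotomy k e with h' | h' | h'
      · have h1 : x i < k ∧ k ≤ e := by omega
        have h2 : x i < k + 1 ∧ k + 1 ≤ e := by omega
        simp [h1, h2, h.ne', hocc k h.le h']
      · subst h'
        simp [h, h.ne', hemp]
      · have h1 : ¬ (x i < k ∧ k ≤ e) := by omega
        have h2 : ¬ (x i < k + 1 ∧ k + 1 ≤ e) := by omega
        rw [if_neg h1, if_neg h2]
        simp [h.ne']

/-- A push shifts the occupied block `[x i, e)` to `(x i, e]`. Forgetting labels, only the site `x
i` is vacated and only `e` is filled, exactly as if one ball had jumped over the block. -/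
theorem configOf_push {d : ℕ} {x : Fin d → ℕ} (i : Fin d)
    {e : ℕ} (hlt : x i < e) (hemp : ∀ l, x l ≠ e)
    (hocc : ∀ m, x i ≤ m → m < e → ∃ l, x l = m) (k : ℕ) :
    configOf (push i x) k = true ↔ k = e ∨ (k ≠ x i ∧ ∃ l, x l = k) := by
  have hmove : ∀ j, (x i ≤ x j ∧ ∀ m ∈ Finset.Icc (x i) (x j), ∃ l, x l = m) ↔
      x i ≤ x j ∧ x j < e := by
    intro j
    refine ⟨fun h => ⟨h.1, ?_⟩, fun h => ⟨h.1, fun m hm => ?_⟩⟩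
    · by_contra hcon
      obtain ⟨l, hl⟩ := h.2 e (Finset.mem_Icc.2 ⟨hlt.le, by omega⟩)
      exact hemp l hl
    · rw [Finset.mem_Icc] at hm
      exact hocc m hm.1 (by omega)
  simp only [configOf, decide_eq_true_eq, push, hmove]
  constructor
  · rintro ⟨j, rfl⟩
    split_ifs with h
    · rcases (Nat.succ_le_of_lt h.2).lt_or_eq with h2 | h2
      · exact Or.inr ⟨by omega, hocc _ (by omega) h2⟩
      · exact Or.inl h2
    · refine Or.inr ⟨fun hj => h ?_, j, rfl⟩
      omega
  -- Each site of the shifted block is filled by the particle that was one site behind it.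
  · rintro (rfl | ⟨hk, j, rfl⟩)
    · obtain ⟨j, hj⟩ := hocc (k - 1) (by omega) (by omega)
      exact ⟨j, by rw [if_pos] <;> omega⟩
    · rcases lt_or_gt_of_ne hk with h | h
      · exact ⟨j, by rw [if_neg]; omega⟩
      · by_cases h2 : x j < e
        · obtain ⟨l, hl⟩ := hocc (x j - 1) (by omega) (by omega)
          exact ⟨l, by rw [if_pos] <;> omega⟩
        · exact ⟨j, by rw [if_neg]; omega⟩

theorem sweep_of_single_success {d : ℕ} {c : ℕ∞} (hc : 1 ≤ c) {x : Fin d → ℕ}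
    (i : Fin d) :
    sweep c (configOf x) (fun k => decide (k = x i)) = configOf (push i x) := by
  obtain ⟨e, hlt, hemp, hocc⟩ := exists_first_empty x i
  funext k
  rw [Bool.eq_iff_iff, configOf_push i hlt hemp hocc]
  simp only [sweep, carrier_of_single_success hc i hlt hemp hocc, decide_eq_true_eq, configOf]
  rcases eq_or_ne k e with rfl | hke
  · simp [hlt]
  · rcases eq_or_ne k (x i) with rfl | hki
    · simp [hlt, hke]
    · have h1 : (x i < k + 1 ∧ k + 1 ≤ e) ↔ (x i < k ∧ k ≤ e) := by omega
      rw [if_congr h1 rfl rfl]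
      simp [hke, hki]

theorem sbbs_succ_of_single_success {d : ℕ} {c : ℕ∞} (hc : 1 ≤ c) (x₀ : Fin d → ℕ)
    (coin : ℕ → Fin d → Bool) {s : ℕ} {x : Fin d → ℕ} (hx : StrictMono x)
    (hs : sbbs c x₀ coin s = configOf x) {i : Fin d} (hi : ∀ j, coin s j = true ↔ j = i) :
    sbbs c x₀ coin (s + 1) = configOf (push i x) := by
  have : siteOutcome (ballPositions d (sbbs c x₀ coin s)) (coin s) = fun k => decide (k = x i) := by
    rw [hs, ballPositions_configOf hx]
    funext k
    simp [siteOutcome, hi, eq_comm]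
  change sweep c (sbbs c x₀ coin s) (siteOutcome (ballPositions d (sbbs c x₀ coin s)) (coin s)) = _
  rw [this, hs, sweep_of_single_success hc]

theorem sbbs_eq_of_no_success {d : ℕ} (c : ℕ∞) (x₀ : Fin d → ℕ) (coin : ℕ → Fin d → Bool)
    {a b : ℕ} (hab : a ≤ b) (h : ∀ s, a ≤ s → s < b → ∀ i, coin s i = false) :
    sbbs c x₀ coin b = sbbs c x₀ coin a := by
  induction b, hab using Nat.le_induction with
  | base => rfl
  | succ n hn ih =>
    rw [sbbs_succ_of_no_success _ _ _ _ (h n hn (Nat.lt_succ_self n)),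
      ih fun s hs hsn => h s hs (hsn.trans (Nat.lt_succ_self n))]

/-! ## Paths driven by ring times -/

/-- `Reaches R x₀ t v`: the ring times `R` in `(0, t]` are separated, and successively pushing the
particles that ring leads from `x₀` at time `0` to `v` at time `t`. -/
inductive Reaches {d : ℕ} (R : Fin d × ℕ → ℝ) (x₀ : Fin d → ℕ) : ℝ≥0 → (Fin d → ℕ) → Prop
  | start (t : ℝ≥0) (h : ∀ p, R p ∉ Set.Ioc (0 : ℝ) t) : Reaches R x₀ t x₀
  | step (s t : ℝ≥0) (v : Fin d → ℕ) (p : Fin d × ℕ) (hv : Reaches R x₀ s v)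
      (hp : R p ∈ Set.Ioc (s : ℝ) t) (hu : ∀ q, R q ∈ Set.Ioc (s : ℝ) t → q = p) :
      Reaches R x₀ t (push p.1 v)

theorem Reaches.strictMono {d : ℕ} {R : Fin d × ℕ → ℝ} {x₀ : Fin d → ℕ} (hx₀ : StrictMono x₀)
    {t : ℝ≥0} {v : Fin d → ℕ} (h : Reaches R x₀ t v) : StrictMono v := by
  induction h with
  | start => exact hx₀
  | step s t v p hv hp hu ih => exact push_strictMono _ ih

/-- Induction on the number of rings up to `t`, removing the last one. -/
theorem exists_reaches {d : ℕ} {R : Fin d × ℕ → ℝ} (x₀ : Fin d → ℕ) (hpos : ∀ p, 0 < R p)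
    (hinj : Function.Injective R) (hfin : ∀ t : ℝ≥0, {p | R p ≤ t}.Finite) (t : ℝ≥0) :
    ∃ v, Reaches R x₀ t v := by
  induction hn : (hfin t).toFinset.card using Nat.strong_induction_on generalizing t with
  | _ n ih =>
    subst hn
    rcases (hfin t).toFinset.eq_empty_or_nonempty with h0 | hne
    · refine ⟨x₀, .start t fun p hp => ?_⟩
      have : p ∈ (hfin t).toFinset := by simpa using hp.2
      simp [h0] at this
    · obtain ⟨p, hp, hmax⟩ := Finset.exists_max_image _ R hne
      have hpt : R p ≤ t := by simpa using hp
      -- `s` is the ring time just before the last one, or 0 if there is none, so that `(s, t]`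
      -- contains a single ring.
      obtain ⟨s, hsp, hs⟩ : ∃ s : ℝ≥0, (s : ℝ) < R p ∧ ∀ q, R q < R p → R q ≤ s := by
        rcases ((hfin t).toFinset.erase p).eq_empty_or_nonempty with h1 | h1
        · refine ⟨0, by simpa using hpos p, fun q hq => ?_⟩
          have : q ∈ (hfin t).toFinset.erase p := by
            simp only [Finset.mem_erase, Set.Finite.mem_toFinset, Set.mem_ofPred_eq]
            exact ⟨fun h => hq.ne (by rw [h]), hq.le.trans hpt⟩
          simp [h1] at this
        · obtain ⟨q, hq, hqmax⟩ := Finset.exists_max_image _ R h1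
          refine ⟨⟨R q, (hpos q).le⟩, ?_, fun r hr => hqmax r ?_⟩
          · rw [Finset.mem_erase] at hq
            exact lt_of_le_of_ne (hmax q hq.2) (hinj.ne hq.1)
          · simp only [Finset.mem_erase, Set.Finite.mem_toFinset, Set.mem_ofPred_eq]
            exact ⟨fun h => hr.ne (by rw [h]), hr.le.trans hpt⟩
      obtain ⟨v, hv⟩ := ih _ (Finset.card_lt_card (s := (hfin s).toFinset)
        (Finset.ssubset_iff_of_subset (fun q hq => by
          simp only [Set.Finite.mem_toFinset, Set.mem_ofPred_eq] at hq ⊢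
          linarith) |>.2 ⟨p, hp, by simpa using hsp⟩)) s rfl
      refine ⟨_, .step s t v p hv ⟨hsp, hpt⟩ fun q hq => ?_⟩
      by_contra hqp
      have h1 : R q ≤ R p := hmax q (by simpa using hq.2)
      exact absurd (hs q (lt_of_le_of_ne h1 (hinj.ne hqp))) (not_le.2 hq.1)

/-- A derivation of `Reaches` uses the ring times only through comparisons with deterministic times,
and `lam` preserves these up to `T`. -/
theorem Reaches.timeChange {d : ℕ} {R R' : Fin d × ℕ → ℝ} {x₀ : Fin d → ℕ} {T : ℝ≥0}
    (lam : ℝ≥0 ≃o ℝ≥0) (hlam : ∀ p, ∀ t ≤ T, R p ≤ t ↔ R' p ≤ lam t)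
    {t : ℝ≥0} {v : Fin d → ℕ} (h : Reaches R x₀ t v) (ht : t ≤ T) :
    Reaches R' x₀ (lam t) v := by
  have key : ∀ p, ∀ s ≤ T, ∀ t ≤ T, R p ∈ Set.Ioc (s : ℝ) t ↔
      R' p ∈ Set.Ioc (lam s : ℝ) (lam t) := by
    intro p s hs t ht
    simp only [Set.mem_Ioc, ← not_le, hlam p s hs, hlam p t ht]
  have h0 : lam 0 = 0 := lam.map_bot
  induction h with
  | start t h =>
    refine .start _ fun p hp => h p ?_
    have := key p 0 zero_le t ht
    rw [h0] at this
    exact this.2 hp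
  | step s t v p hv hp hu ih =>
    have hs : s ≤ T := by
      have : (s : ℝ) < t := hp.1.trans_le hp.2
      exact (NNReal.coe_lt_coe.1 this).le.trans ht
    exact .step (lam s) (lam t) v p (ih hs) ((key p s hs t ht).1 hp)
      fun q hq => hu q ((key q s hs t ht).2 hq)

/-- The path value at each time is the state that the ring times lead to. -/
def IsDrivenBy {d : ℕ} (x₀ : Fin d → ℕ) (R : Fin d × ℕ → ℝ) (x : ℝ≥0 → Fin d → ℕ) : Prop :=
  ∀ t v, Reaches R x₀ t v → x t = v

/-- The time of the `n`-th ring of the clock of particle `i`, for waiting times `τ`. -/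
def ringTime {d : ℕ} (τ : Fin d → ℕ → ℝ) (p : Fin d × ℕ) : ℝ :=
  ∑ k ∈ Finset.range (p.2 + 1), τ p.1 k

/-- Without jumps the path is continuous on the interval, and a continuous map from an interval to a
discrete space is constant. -/
theorem eq_of_no_jump {E : Type*} [TopologicalSpace E] [DiscreteTopology E] (x : CadlagPath E)
    {s t : ℝ≥0} (hst : s ≤ t) (h : ∀ u, s < u → u ≤ t → ∀ y, Tendsto x (𝓝[<] u) (𝓝 y) → x u = y) :
    x t = x s := by
  have hcont : ContinuousOn x (Set.Icc s t) := by
    intro u hu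
    rcases hu.1.eq_or_lt with rfl | hsu
    · exact (x.right_continuous s).mono fun v hv => hv.1
    · obtain ⟨y, hy⟩ := x.left_limit u
      have hxu := h u hsu hu.2 y hy
      have hl : ContinuousWithinAt x (Set.Iio u) u := by
        rw [ContinuousWithinAt, hxu]; exact hy
      have := hl.union (x.right_continuous u)
      exact this.mono fun v _ => lt_or_ge v u
  exact isPreconnected_Icc.constant hcont (Set.right_mem_Icc.2 hst) (Set.left_mem_Icc.2 hst)

theorem isDrivenBy_of_pushTASEP {d : ℕ} {x₀ : Fin d → ℕ} {τ : Fin d → ℕ → ℝ}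
    (x : CadlagPath (Fin d → ℕ)) (h0 : x 0 = x₀)
    (h : ∀ t : ℝ≥0, 0 < t → ∀ y : Fin d → ℕ, Tendsto x (𝓝[<] t) (𝓝 y) →
      (∀ i, RingsAt τ i t → x t = push i y) ∧ ((∀ i, ¬ RingsAt τ i t) → x t = y)) :
    IsDrivenBy x₀ (ringTime τ) x := by
  have hconst : ∀ s t : ℝ≥0, s ≤ t → (∀ p, ringTime τ p ∉ Set.Ioc (s : ℝ) t) → x t = x s := by
    intro s t hst hno
    refine eq_of_no_jump x hst fun u hsu hut y hy => (h u (bot_le.trans_lt hsu) y hy).2 ?_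
    rintro i ⟨n, hn⟩
    exact hno (i, n) (by
      rw [ringTime, hn]
      exact ⟨NNReal.coe_lt_coe.2 hsu, NNReal.coe_le_coe.2 hut⟩)
  intro t v hv
  induction hv with
  | start t hno => rw [hconst 0 t zero_le (by simpa using hno), h0]
  | step s t v p _ hp hu ih =>
    obtain ⟨u, hu'⟩ : ∃ u : ℝ≥0, (u : ℝ) = ringTime τ p :=
      ⟨⟨ringTime τ p, s.2.trans hp.1.le⟩, rfl⟩
    rw [← hu'] at hp
    have hsu : s < u := NNReal.coe_lt_coe.1 hp.1
    have hut : u ≤ t := NNReal.coe_le_coe.1 hp.2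
    -- There is no ring in `(s, u)`, so the path keeps the value `v` until just before the ring at
    -- `u`.
    have hleft : Tendsto x (𝓝[<] u) (𝓝 v) := by
      refine tendsto_const_nhds.congr' ?_
      filter_upwards [Ioo_mem_nhdsLT hsu] with w hw
      rw [← ih, hconst s w hw.1.le]
      intro q hq
      have hqp := hu q ⟨hq.1, hq.2.trans (NNReal.coe_le_coe.2 (hw.2.le.trans hut))⟩
      rw [hqp, ← hu'] at hq
      exact absurd hq.2 (not_le.2 (NNReal.coe_lt_coe.2 hw.2))
    rw [hconst u t hut, (h u (bot_le.trans_lt hsu) v hleft).1 p.1 ⟨p.2, hu'.symm⟩]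
    intro q hq
    have hqp := hu q ⟨hp.1.trans hq.1, hq.2⟩
    rw [hqp, ← hu'] at hq
    exact lt_irrefl _ hq.1

/-- `M (i, n)` is the time at which the sweep with the `n`-th success of ball `i` ends. The sweep
from `s` to `s + 1` therefore shows its effect at time `s + 1`, that is, at rescaled time `(1 - ε) *
(s + 1)`. -/
theorem isDrivenBy_sbbs {d : ℕ} {c : ℕ∞} (hc : 1 ≤ c) {x₀ : Fin d → ℕ} (hx₀ : StrictMono x₀)
    {M : Fin d × ℕ → ℕ} {coin : ℕ → Fin d → Bool}
    (hcoin : ∀ s i, coin s i = true ↔ ∃ n, M (i, n) = s + 1) (ε : Set.Ioo (0 : ℝ) 1) :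
    IsDrivenBy x₀ (fun p => (1 - (ε : ℝ)) * M p)
      (floorPath ε fun n => ballPositions d (sbbs c x₀ coin n)) := by
  have hb : 0 < 1 - (ε : ℝ) := by linarith [ε.2.2]
  have hmem : ∀ (p : Fin d × ℕ) (s t : ℝ≥0), (1 - (ε : ℝ)) * M p ∈ Set.Ioc (s : ℝ) t ↔
      ⌊(s : ℝ) / (1 - (ε : ℝ))⌋₊ < M p ∧ M p ≤ ⌊(t : ℝ) / (1 - (ε : ℝ))⌋₊ := by
    intro p s t
    rw [Set.mem_Ioc, Nat.floor_lt (by positivity), Nat.le_floor_iff (by positivity),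
      div_lt_iff₀' hb, le_div_iff₀' hb]
  have hcfalse : ∀ s i, (∀ n, M (i, n) ≠ s + 1) → coin s i = false := by
    intro s i h
    rw [← Bool.not_eq_true, hcoin]
    push Not
    exact h
  have key : ∀ t v, Reaches (fun p => (1 - (ε : ℝ)) * M p) x₀ t v →
      sbbs c x₀ coin ⌊(t : ℝ) / (1 - (ε : ℝ))⌋₊ = configOf v := by
    intro t v hv
    induction hv with
    | start t hno =>
      rw [sbbs_eq_of_no_success c x₀ coin (Nat.zero_le _)]
      · rfl
      · intro s _ hs i
        refine hcfalse s i fun n hn => hno (i, n) ?_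
        have := (hmem (i, n) 0 t).2 (by rw [hn]; simpa using hs)
        simpa using this
    | step s t v p hv hp hu ih =>
      have hp' := (hmem p s t).1 hp
      have hu' : ∀ q, _ → q = p := fun q hq => hu q ((hmem q s t).2 hq)
      set a := ⌊(s : ℝ) / (1 - (ε : ℝ))⌋₊
      set b := ⌊(t : ℝ) / (1 - (ε : ℝ))⌋₊
      -- The sweeps from `a` to `b` split into failures before sweep `m`, the single success in
      -- sweep `m`, and failures after it.
      obtain ⟨m, hm⟩ : ∃ m, M p = m + 1 := ⟨M p - 1, by omega⟩
      rw [sbbs_eq_of_no_success c x₀ coin (a := m + 1) (by omega)]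
      · refine sbbs_succ_of_single_success hc x₀ coin (hv.strictMono hx₀) ?_ fun j => ?_
        · rw [sbbs_eq_of_no_success c x₀ coin (a := a) (by omega), ih]
          intro r hr hrm i
          refine hcfalse r i fun n hn => ?_
          have := hu' (i, n) (by omega)
          rw [this] at hn
          omega
        · rw [hcoin]
          constructor
          · rintro ⟨n, hn⟩
            rw [← hu' (j, n) (by omega)]
          · rintro rfl
            exact ⟨p.2, hm⟩
      · intro r hr hrb i
        refine hcfalse r i fun n hn => ?_
        have := hu' (i, n) (by omega)
        rw [this] at hn
        omega
  intro t v hv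
  change ballPositions d (sbbs c x₀ coin ⌊(t : ℝ) / (1 - (ε : ℝ))⌋₊) = v
  rw [key t v hv, ballPositions_configOf (hv.strictMono hx₀)]

/-! ## Convergence in the Skorokhod topology from convergence of the ring times -/

/-- The identity is perturbed by tents of height `R' p - R p` and half-width `r` centred at `R p`.
Separation makes each tent vanish at 0 and at the other ring times, so `R p` is sent to `R' p`. The
slopes of the perturbation total at most `1 / 2`, so the map stays strictly increasing. -/
theorem exists_timeChange {ι : Type*} [DecidableEq ι] (J : Finset ι) (R R' : ι → ℝ) {r : ℝ}
    (hr : 0 < r) (hpos : ∀ p ∈ J, r ≤ R p) (hsep : ∀ p ∈ J, ∀ q ∈ J, p ≠ q → r ≤ |R p - R q|)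
    (hsmall : ∑ p ∈ J, |R' p - R p| ≤ r / 2) :
    ∃ lam : ℝ≥0 ≃o ℝ≥0, (∀ t : ℝ≥0, |(lam t : ℝ) - t| ≤ ∑ p ∈ J, |R' p - R p|) ∧
      ∀ p ∈ J, ∀ t : ℝ≥0, R p ≤ t ↔ R' p ≤ lam t := by
  set φ : ι → ℝ → ℝ := fun p t => max 0 (1 - |t - R p| / r) with hφ
  have hφ0 : ∀ p t, 0 ≤ φ p t := fun p t => le_max_left _ _
  have hφ1 : ∀ p t, φ p t ≤ 1 := fun p t => max_le zero_le_one (by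
    have : 0 ≤ |t - R p| / r := by positivity
    linarith)
  have hφfar : ∀ p t, r ≤ |t - R p| → φ p t = 0 := fun p t h => max_eq_left (by
    have : 1 ≤ |t - R p| / r := (one_le_div hr).2 h
    linarith)
  have hφlip : ∀ p s t, |φ p t - φ p s| ≤ |t - s| / r := by
    intro p s t
    have h1 : |φ p t - φ p s| ≤ |(1 - |t - R p| / r) - (1 - |s - R p| / r)| := by
      have := abs_max_sub_max_le_max 0 (1 - |t - R p| / r) 0 (1 - |s - R p| / r)
      simpa [hφ] using this
    refine h1.trans ?_
    have h2 : (1 - |t - R p| / r) - (1 - |s - R p| / r) = (|s - R p| - |t - R p|) / r := by ring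
    rw [h2, abs_div, abs_of_pos hr]
    refine div_le_div_of_nonneg_right ?_ hr.le
    rw [abs_sub_comm t s]
    have h3 := abs_abs_sub_abs_le (s - R p) (t - R p)
    rwa [sub_sub_sub_cancel_right] at h3
  set g : ℝ → ℝ := fun t => ∑ p ∈ J, (R' p - R p) * φ p t with hg
  have hglip : ∀ s t, |g t - g s| ≤ |t - s| / 2 := by
    intro s t
    calc |g t - g s| = |∑ p ∈ J, (R' p - R p) * (φ p t - φ p s)| := by
          rw [hg, ← Finset.sum_sub_distrib]
          simp only [mul_sub]
      _ ≤ ∑ p ∈ J, |R' p - R p| * (|t - s| / r) := by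
          refine (Finset.abs_sum_le_sum_abs _ _).trans (Finset.sum_le_sum fun p _ => ?_)
          rw [abs_mul]
          exact mul_le_mul_of_nonneg_left (hφlip p s t) (abs_nonneg _)
      _ = (∑ p ∈ J, |R' p - R p|) * (|t - s| / r) := by rw [Finset.sum_mul]
      _ ≤ (r / 2) * (|t - s| / r) := by gcongr
      _ = |t - s| / 2 := by field_simp
  have hgbound : ∀ t, |g t| ≤ ∑ p ∈ J, |R' p - R p| := by
    intro t
    refine (Finset.abs_sum_le_sum_abs _ _).trans (Finset.sum_le_sum fun p _ => ?_)
    rw [abs_mul, abs_of_nonneg (hφ0 p t)]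
    exact mul_le_of_le_one_right (abs_nonneg _) (hφ1 p t)
  set f : ℝ → ℝ := fun t => t + g t with hf
  have hfmono : StrictMono f := by
    intro s t hst
    have h1 := (abs_le.1 (hglip s t)).1
    rw [abs_of_pos (sub_pos.2 hst)] at h1
    simp only [hf]
    linarith
  have hf0 : f 0 = 0 := by
    simp only [hf, hg, zero_add]
    refine Finset.sum_eq_zero fun p hp => ?_
    rw [hφfar p 0, mul_zero]
    rw [zero_sub, abs_neg]
    exact (hpos p hp).trans (le_abs_self _)
  have hfR : ∀ p ∈ J, f (R p) = R' p := by
    intro p hp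
    have : g (R p) = (R' p - R p) * φ p (R p) :=
      Finset.sum_eq_single_of_mem p hp fun q hq hqp => by
        rw [hφfar q _ (hsep p hp q hq hqp.symm), mul_zero]
    simp only [hf, this]
    simp [hφ]
  have hfcont : Continuous f := by
    simp only [hf, hg, hφ]
    fun_prop
  have hfnn : ∀ t : ℝ≥0, 0 ≤ f t := fun t => by
    rw [← hf0]; exact hfmono.monotone t.2
  let F : ℝ≥0 → ℝ≥0 := fun t => ⟨f t, hfnn t⟩
  have hFmono : StrictMono F := fun s t hst => hfmono (NNReal.coe_lt_coe.2 hst)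
  have hFsurj : Function.Surjective F := by
    intro y
    -- Since `g` vanishes at 0 and has Lipschitz constant `1 / 2`, `f (2 * y) ≥ 2 * y - y`.
    have hy : (y : ℝ) ∈ Set.Icc (f 0) (f (2 * y)) := by
      refine ⟨by rw [hf0]; exact y.2, ?_⟩
      have h1 := (abs_le.1 (hglip 0 (2 * y))).1
      have h2 : g 0 = 0 := by simpa [hf] using hf0
      rw [h2, sub_zero, sub_zero, abs_of_nonneg (by positivity)] at h1
      simp only [hf]
      linarith
    obtain ⟨t, ht, hty⟩ := intermediate_value_Icc (by positivity) hfcont.continuousOn hy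
    exact ⟨⟨t, ht.1⟩, NNReal.eq hty⟩
  refine ⟨hFmono.orderIsoOfSurjective F hFsurj, fun t => ?_, fun p hp t => ?_⟩
  · change |f t - t| ≤ _
    simpa [hf] using hgbound t
  · change _ ↔ R' p ≤ f t
    rw [← hfR p hp, hfmono.le_iff_le]

/-- Ring times for which the driven path is well defined: they are positive and pairwise distinct,
and the rings of each particle are ordered and do not accumulate. -/
structure IsProperRinging {d : ℕ} (R : Fin d × ℕ → ℝ) : Prop where
  pos : ∀ p, 0 < R p
  injective : Function.Injective R
  monotone : ∀ i, Monotone fun n => R (i, n)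
  tendsto : ∀ i, Tendsto (fun n => R (i, n)) atTop atTop

theorem IsProperRinging.exists_lt {d : ℕ} {R : Fin d × ℕ → ℝ} (hR : IsProperRinging R) (T : ℝ) :
    ∃ N, ∀ i, T < R (i, N) :=
  (eventually_all.2 fun i => (hR.tendsto i).eventually_gt_atTop T).exists

theorem IsProperRinging.finite {d : ℕ} {R : Fin d × ℕ → ℝ} (hR : IsProperRinging R) (t : ℝ≥0) :
    {p | R p ≤ t}.Finite := by
  obtain ⟨N, hN⟩ := hR.exists_lt t
  refine (Finset.finite_toSet (Finset.univ ×ˢ Finset.range N)).subset fun p hp => ?_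
  simp only [Finset.coe_product, Set.mem_prod, Finset.coe_univ, Set.mem_univ, Finset.coe_range,
    Set.mem_Iio, true_and]
  by_contra hcon
  have h1 : R (p.1, N) ≤ R p := hR.monotone p.1 (not_lt.1 hcon)
  have h2 : R p ≤ t := hp
  exact absurd (hN p.1) (not_lt.2 (h1.trans h2))

theorem IsProperRinging.exists_separation {d : ℕ} {R : Fin d × ℕ → ℝ} (hR : IsProperRinging R)
    (J : Finset (Fin d × ℕ)) :
    ∃ r > 0, (∀ p ∈ J, r ≤ R p) ∧ ∀ p ∈ J, ∀ q ∈ J, p ≠ q → r ≤ |R p - R q| := by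
  have key : ∀ b : ℝ, 0 < b → ∀ᶠ r in 𝓝[>] (0 : ℝ), r ≤ b := fun b hb => by
    filter_upwards [Ioo_mem_nhdsGT hb] with r hr using hr.2.le
  have h1 : ∀ᶠ r in 𝓝[>] (0 : ℝ), ∀ p ∈ J, r ≤ R p :=
    (Finset.eventually_all J).2 fun p _ => key _ (hR.pos p)
  have h2 : ∀ᶠ r in 𝓝[>] (0 : ℝ), ∀ p ∈ J, ∀ q ∈ J, p ≠ q → r ≤ |R p - R q| := by
    refine (Finset.eventually_all J).2 fun p _ => (Finset.eventually_all J).2 fun q _ => ?_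
    by_cases hpq : p = q
    · exact Eventually.of_forall fun _ h => absurd hpq h
    · filter_upwards [key _ (abs_pos.2 (sub_ne_zero.2 (hR.injective.ne hpq)))] with r hr _ using hr
  obtain ⟨r, hr0, hr1, hr2⟩ := ((eventually_mem_nhdsWithin (a := (0 : ℝ))).and (h1.and h2)).exists
  exact ⟨r, hr0, hr1, hr2⟩

theorem IsDrivenBy.unique {d : ℕ} {x₀ : Fin d → ℕ} {R : Fin d × ℕ → ℝ} (hR : IsProperRinging R)
    {x y : CadlagPath (Fin d → ℕ)} (hx : IsDrivenBy x₀ R x) (hy : IsDrivenBy x₀ R y) : x = y := by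
  have : x.toFun = y.toFun := by
    funext t
    obtain ⟨v, hv⟩ := exists_reaches x₀ hR.pos hR.injective hR.finite t
    exact (hx t v hv).trans (hy t v hv).symm
  cases x
  cases y
  subst this
  rfl

theorem tendsto_of_isDrivenBy {d : ℕ} {x₀ : Fin d → ℕ} {ι : Type*} {l : Filter ι}
    {R : Fin d × ℕ → ℝ} {R' : ι → Fin d × ℕ → ℝ} (hR : IsProperRinging R)
    (hR' : ∀ᶠ a in l, ∀ i, Monotone fun n => R' a (i, n))
    (hconv : ∀ p, Tendsto (fun a => R' a p) l (𝓝 (R p)))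
    {x : CadlagPath (Fin d → ℕ)} {y : ι → CadlagPath (Fin d → ℕ)}
    (hx : IsDrivenBy x₀ R x) (hy : ∀ᶠ a in l, IsDrivenBy x₀ (R' a) (y a)) :
    Tendsto y l (𝓝 x) := by
  rw [tendsto_nhds]
  intro U hU hxU
  obtain ⟨T, δ, hδ, hsub⟩ := hU x hxU
  -- The margin 1 absorbs the displacement of the time change: rings outside `J` come after `T + 1`
  -- in both systems, hence after `s` and after `lam s` for every `s ≤ T`.
  obtain ⟨N, hN⟩ := hR.exists_lt (T + 1)
  set J : Finset (Fin d × ℕ) := Finset.univ ×ˢ Finset.range N with hJ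
  obtain ⟨r, hr, hr1, hr2⟩ := hR.exists_separation J
  have hsum : Tendsto (fun a => ∑ p ∈ J, |R' a p - R p|) l (𝓝 0) := by
    have : Tendsto (fun a => ∑ p ∈ J, |R' a p - R p|) l (𝓝 (∑ p ∈ J, |R p - R p|)) :=
      tendsto_finsetSum _ fun p _ => ((hconv p).sub_const _).abs
    simpa using this
  have hlate : ∀ᶠ a in l, ∀ i, (T : ℝ) + 1 < R' a (i, N) :=
    eventually_all.2 fun i => (hconv (i, N)).eventually_const_lt (hN i)
  filter_upwards [hR', hy, hlate, hsum.eventually_lt_const (half_pos hr),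
    hsum.eventually_lt_const hδ, hsum.eventually_lt_const one_pos] with a hmono hya hla h1 h2 h3
  refine hsub ?_
  obtain ⟨lam, hlam, hiff⟩ := exists_timeChange J R (R' a) hr hr1 hr2 h1.le
  refine ⟨lam, fun t ht => ⟨(hlam t).trans_lt h2, ?_⟩⟩
  have hle : ∀ p, ∀ s ≤ T, R p ≤ s ↔ R' a p ≤ lam s := by
    intro p s hs
    by_cases hp : p ∈ J
    · exact hiff p hp s
    · have hpN : N ≤ p.2 := by
        by_contra hcon
        exact hp (by simp [hJ, not_le.1 hcon])
      have hs' : (s : ℝ) ≤ T := NNReal.coe_le_coe.2 hs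
      have h4 : R (p.1, N) ≤ R p := hR.monotone p.1 hpN
      have h5 : R' a (p.1, N) ≤ R' a p := hmono p.1 hpN
      have h6 := (abs_le.1 (hlam s)).2
      have h7 := hN p.1
      have h8 := hla p.1
      constructor <;> intro h <;> exfalso <;> linarith
  obtain ⟨v, hv⟩ := exists_reaches x₀ hR.pos hR.injective hR.finite t
  rw [hx t v hv, hya _ _ (hv.timeChange lam hle ht), dist_self]
  exact hδ

/-! ## Measurability -/

/-- On `[0, T]` the path depends on finitely many values of `f`, and in a discrete space these are
locally constant; no time change is needed. -/
theorem continuous_floorPath {E : Type*} [PseudoMetricSpace E] [DiscreteTopology E]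
    (ε : Set.Ioo (0 : ℝ) 1) : Continuous fun f : ℕ → E => floorPath ε f := by
  rw [continuous_iff_continuousAt]
  intro f
  rw [ContinuousAt, tendsto_nhds]
  intro U hU hfU
  obtain ⟨T, δ, hδ, hsub⟩ := hU _ hfU
  have hb : 0 < 1 - (ε : ℝ) := by linarith [ε.2.2]
  have hev : ∀ᶠ g in 𝓝 f, ∀ n ∈ Finset.range (⌊(T : ℝ) / (1 - (ε : ℝ))⌋₊ + 1), g n = f n := by
    refine (Finset.eventually_all _).2 fun n _ => ?_
    have := (continuous_apply (A := fun _ : ℕ => E) n).continuousAt (x := f)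
    exact this.eventually (p := fun y => y = f n) (by rw [nhds_discrete]; exact eventually_pure.2 rfl)
  filter_upwards [hev] with g hg
  refine hsub ⟨OrderIso.refl _, fun t ht => ⟨by simpa using hδ, ?_⟩⟩
  have : ⌊(t : ℝ) / (1 - (ε : ℝ))⌋₊ ≤ ⌊(T : ℝ) / (1 - (ε : ℝ))⌋₊ := by
    apply Nat.floor_le_floor
    gcongr
  have h := hg _ (Finset.mem_range.2 (Nat.lt_succ_of_le this))
  change dist (f ⌊(t : ℝ) / (1 - (ε : ℝ))⌋₊) (g ⌊(t : ℝ) / (1 - (ε : ℝ))⌋₊) < δ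
  rw [h, dist_self]
  exact hδ

theorem isLocallyConstant_sbbs {d : ℕ} (c : ℕ∞) (x₀ : Fin d → ℕ) (n : ℕ) :
    IsLocallyConstant fun coin : ℕ → Fin d → Bool => sbbs c x₀ coin n := by
  induction n with
  | zero => exact IsLocallyConstant.const _
  | succ n ih =>
    have h : IsLocallyConstant fun coin : ℕ → Fin d → Bool => coin n :=
      (IsLocallyConstant.iff_continuous _).2 (continuous_apply n)
    exact (ih.prodMk h).comp fun q => sweep c q.1 (siteOutcome (ballPositions d q.1) q.2)

theorem measurable_sbbsPath {d : ℕ} (c : ℕ∞) (x₀ : Fin d → ℕ) (ε : Set.Ioo (0 : ℝ) 1) :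
    Measurable fun coin : ℕ → Fin d → Bool =>
      floorPath ε fun n => ballPositions d (sbbs c x₀ coin n) := by
  have h : ∀ n, Continuous fun coin : ℕ → Fin d → Bool => ballPositions d (sbbs c x₀ coin n) :=
    fun n => ((isLocallyConstant_sbbs c x₀ n).comp (ballPositions d)).continuous
  exact ((continuous_floorPath ε).comp (continuous_pi h)).measurable

/-- Measurability of `X` is derived, not assumed: almost surely `X` is a function of the ring times,
and `tendsto_of_isDrivenBy` with constant target data makes this function continuous on the set of
ring sequences that occur. -/
theorem aemeasurable_of_isDrivenBy {d : ℕ} {x₀ : Fin d → ℕ} {Ω : Type*} [MeasurableSpace Ω]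
    {P : Measure Ω} {X : Ω → CadlagPath (Fin d → ℕ)} {R : Ω → Fin d × ℕ → ℝ} (hRm : Measurable R)
    (h : ∀ᵐ ω ∂P, IsProperRinging (R ω) ∧ IsDrivenBy x₀ (R ω) (X ω)) : AEMeasurable X P := by
  obtain ⟨A, hAsub, hAm, hA⟩ : ∃ A, (∀ ω ∈ A, IsProperRinging (R ω) ∧ IsDrivenBy x₀ (R ω) (X ω)) ∧
      MeasurableSet A ∧ ∀ᵐ ω ∂P, ω ∈ A := by
    obtain ⟨A, hA, hAm, hAsub⟩ := h.exists_measurable_mem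
    exact ⟨A, hAsub, hAm, hA⟩
  -- `S` need not be measurable; only its subspace structure is used. Uniqueness of the driven path
  -- makes the choice of preimages harmless.
  let S : Set (Fin d × ℕ → ℝ) := R '' A
  choose ω₀ hω₀ using fun s : S => s.2
  have hcont : Continuous fun s : S => X (ω₀ s) := by
    rw [continuous_iff_continuousAt]
    intro s
    have hs := hAsub _ (hω₀ s).1
    rw [(hω₀ s).2] at hs
    refine tendsto_of_isDrivenBy (R' := fun a : S => (a : Fin d × ℕ → ℝ)) hs.1 ?_ ?_ hs.2 ?_
    · refine Eventually.of_forall fun a => ?_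
      rw [← (hω₀ a).2]
      exact (hAsub _ (hω₀ a).1).1.monotone
    · exact fun p => ((continuous_apply p).comp continuous_subtype_val).continuousAt
    · refine Eventually.of_forall fun a => ?_
      have := (hAsub _ (hω₀ a).1).2
      rwa [(hω₀ a).2] at this
  have hmeas : Measurable fun ω : A => X ω := by
    have h1 : Measurable fun ω : A => (⟨R ω, ω, ω.2, rfl⟩ : S) :=
      (hRm.comp measurable_subtype_coe).subtype_mk
    convert hcont.measurable.comp h1 using 1
    funext ω
    have h2 := hAsub ω ω.2
    have h3 := hAsub _ (hω₀ ⟨R ω, ω, ω.2, rfl⟩).1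
    rw [(hω₀ ⟨R ω, ω, ω.2, rfl⟩).2] at h3
    exact h2.2.unique h2.1 h3.2
  have := aemeasurable_restrict_of_measurable_subtype (μ := P) hAm hmeas
  rwa [Measure.restrict_eq_self_of_ae_mem hA] at this

/-! ## Exponential waiting times -/

theorem measure_lt_of_hasLaw_exp {Ω : Type*} [MeasurableSpace Ω] {P : Measure Ω} {U : Ω → ℝ}
    (hU : HasLaw U (expMeasure 1) P) {x : ℝ} (hx : 0 ≤ x) :
    P {ω | x < U ω} = ENNReal.ofReal (Real.exp (-x)) := by
  have : IsProbabilityMeasure (expMeasure 1) := isProbabilityMeasure_expMeasure one_pos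
  have h1 : P {ω | x < U ω} = expMeasure 1 (Set.Ioi x) := hU.measure_eq measurableSet_Ioi
  have h2 : (expMeasure 1).real (Set.Iic x) = 1 - Real.exp (-x) := by
    rw [← cdf_eq_real, cdf_expMeasure_eq one_pos, if_pos hx, one_mul]
  rw [h1, ← ofReal_measureReal, ← Set.compl_Iic, measureReal_compl measurableSet_Iic, h2]
  simp

theorem nullSingletonClass_expMeasure : NullSingletonClass (expMeasure 1) :=
  ⟨fun x => withDensity_absolutelyContinuous _ _ (measure_singleton x)⟩

/-- By Fubini: for each value of `U`, the atomless `V` would have to hit one point. -/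
theorem measure_add_eq_zero {Ω : Type*} [MeasurableSpace Ω] {P : Measure Ω}
    [IsProbabilityMeasure P] {U V : Ω → ℝ} (hU : Measurable U) (hV : Measurable V)
    (hind : IndepFun U V P) [NullSingletonClass (P.map V)] : P {ω | U ω + V ω = 0} = 0 := by
  have : IsProbabilityMeasure (P.map V) := Measure.isProbabilityMeasure_map hV.aemeasurable
  have hs : MeasurableSet {z : ℝ × ℝ | z.1 + z.2 = 0} :=
    measurableSet_eq_fun (measurable_fst.add measurable_snd) measurable_const
  have h1 : P {ω | U ω + V ω = 0} = P.map (fun ω => (U ω, V ω)) {z : ℝ × ℝ | z.1 + z.2 = 0} := by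
    rw [Measure.map_apply (hU.prodMk hV) hs]
    rfl
  rw [h1, (indepFun_iff_map_prod_eq_prod_map_map hU.aemeasurable hV.aemeasurable).1 hind,
    Measure.measure_prod_null hs]
  refine Eventually.of_forall fun x => ?_
  have : Prod.mk x ⁻¹' {z : ℝ × ℝ | z.1 + z.2 = 0} = {-x} := by
    ext y
    simp only [Set.mem_preimage, Set.mem_ofPred_eq, Set.mem_singleton_iff]
    constructor <;> intro h <;> linarith
  change P.map V (Prod.mk x ⁻¹' {z : ℝ × ℝ | z.1 + z.2 = 0}) = 0
  rw [this, measure_singleton]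

section Clocks

variable {Ω : Type*} [MeasurableSpace Ω] {P : Measure Ω} [IsProbabilityMeasure P] {d : ℕ}
  {τ : Fin d → ℕ → Ω → ℝ}

theorem ae_pos_of_hasLaw_exp (hlaw : ∀ i n, HasLaw (τ i n) (expMeasure 1) P) :
    ∀ᵐ ω ∂P, ∀ i n, 0 < τ i n ω := by
  refine ae_all_iff.2 fun i => ae_all_iff.2 fun n => ?_
  have h := measure_lt_of_hasLaw_exp (hlaw i n) le_rfl
  rw [neg_zero, Real.exp_zero, ENNReal.ofReal_one] at h
  have hnull : NullMeasurableSet {ω | 0 < τ i n ω} P :=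
    nullMeasurableSet_lt aemeasurable_const (hlaw i n).aemeasurable
  exact (prob_compl_eq_zero_iff₀ hnull).2 h

/-- By the second Borel–Cantelli lemma infinitely many waiting times exceed 1, so the series of
positive terms diverges. -/
theorem ae_tendsto_sum_of_hasLaw_exp (hm : ∀ i n, Measurable (τ i n))
    (hlaw : ∀ i n, HasLaw (τ i n) (expMeasure 1) P)
    (hind : iIndepFun (fun p : Fin d × ℕ => τ p.1 p.2) P) :
    ∀ᵐ ω ∂P, ∀ i, Tendsto (fun n => ∑ k ∈ Finset.range n, τ i k ω) atTop atTop := by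
  refine ae_all_iff.2 fun i => ?_
  have hmeas : ∀ n, MeasurableSet {ω | 1 < τ i n ω} := fun n =>
    measurableSet_lt measurable_const (hm i n)
  have hindrow : iIndepFun (fun n => τ i n) P :=
    hind.precomp (g := fun n : ℕ => (i, n)) fun a b h => (Prod.mk.inj h).2
  have hset : iIndepSet (fun n => {ω | 1 < τ i n ω}) P := by
    refine (iIndepSet_iff_meas_biInter hmeas).2 fun s => ?_
    exact hindrow.measure_inter_preimage_eq_mul s (sets := fun _ => Set.Ioi 1)
      fun _ _ => measurableSet_Ioi
  have hsum : ∑' n, P {ω | 1 < τ i n ω} = ∞ := by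
    simp_rw [fun n => measure_lt_of_hasLaw_exp (hlaw i n) zero_le_one]
    exact ENNReal.tsum_const_eq_top_of_ne_zero (by simp [Real.exp_pos])
  have h1 := measure_limsup_eq_one hmeas hset hsum
  have h2 : ∀ᵐ ω ∂P, ω ∈ limsup (fun n => {ω | 1 < τ i n ω}) atTop :=
    (mem_ae_iff_prob_eq_one (MeasurableSet.measurableSet_limsup hmeas)).2 h1
  filter_upwards [h2, ae_pos_of_hasLaw_exp hlaw] with ω hω hpos
  rw [mem_limsup_iff_frequently_mem] at hω
  refine (not_summable_iff_tendsto_nat_atTop_of_nonneg fun n => (hpos i n).le).1 fun hs => ?_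
  refine hω ?_
  filter_upwards [hs.tendsto_atTop_zero.eventually_lt_const one_pos] with n hn h
  exact lt_asymm hn h

theorem measure_ringTime_eq (hm : ∀ i n, Measurable (τ i n))
    (hlaw : ∀ i n, HasLaw (τ i n) (expMeasure 1) P)
    (hind : iIndepFun (fun p : Fin d × ℕ => τ p.1 p.2) P) {p q : Fin d × ℕ} (hpq : p.1 ≠ q.1) :
    P {ω | ringTime (fun i n => τ i n ω) p = ringTime (fun i n => τ i n ω) q} = 0 := by
  -- With these signs the difference of the two ring times is one sum of independent terms, from
  -- which the atomless term `τ p.1 0` is split off.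
  set σ : Fin d × ℕ → Ω → ℝ := fun t ω => if t.1 = p.1 then τ t.1 t.2 ω else -τ t.1 t.2 ω with hσ
  have hσm : ∀ t, Measurable (σ t) := by
    intro t
    simp only [hσ]
    split_ifs
    exacts [hm _ _, (hm _ _).neg]
  have hσind : iIndepFun σ P := by
    have := hind.comp (fun t x => if t.1 = p.1 then x else -x) fun t => by
      split_ifs
      exacts [measurable_id, measurable_neg]
    exact this
  set s : Finset (Fin d × ℕ) :=
    ({p.1} ×ˢ Finset.range (p.2 + 1)) ∪ ({q.1} ×ˢ Finset.range (q.2 + 1)) with hs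
  have hmem : (p.1, 0) ∈ s := by simp [hs]
  have hsum : ∀ ω, ∑ t ∈ s, σ t ω =
      ringTime (fun i n => τ i n ω) p - ringTime (fun i n => τ i n ω) q := by
    intro ω
    rw [hs, Finset.sum_union, Finset.sum_product, Finset.sum_product]
    · simp [hσ, ringTime, hpq.symm, sub_eq_add_neg]
    · rw [Finset.disjoint_left]
      rintro t h1 h2
      simp only [Finset.mem_product, Finset.mem_singleton] at h1 h2
      exact hpq (h1.1.symm.trans h2.1)
  have hV : σ (p.1, 0) = τ p.1 0 := by
    funext ω
    simp [hσ]
  have : NullSingletonClass (P.map (σ (p.1, 0))) := by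
    rw [hV, (hlaw p.1 0).map_eq]
    exact nullSingletonClass_expMeasure
  have hU : Measurable (∑ t ∈ s.erase (p.1, 0), σ t) := by
    rw [Finset.sum_fn]
    exact Finset.measurable_fun_sum _ fun t _ => hσm t
  have h := measure_add_eq_zero hU (hσm (p.1, 0))
    (hσind.indepFun_finsetSum_of_notMem hσm (Finset.notMem_erase _ s))
  refine measure_mono_null (fun ω hω => ?_) h
  have h2 := Finset.sum_erase_add s (fun t => σ t ω) hmem
  rw [hsum, sub_eq_zero.2 hω] at h2
  simpa using h2

theorem ae_isProperRinging (hm : ∀ i n, Measurable (τ i n))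
    (hlaw : ∀ i n, HasLaw (τ i n) (expMeasure 1) P)
    (hind : iIndepFun (fun p : Fin d × ℕ => τ p.1 p.2) P) :
    ∀ᵐ ω ∂P, IsProperRinging (ringTime fun i n => τ i n ω) := by
  have hne : ∀ᵐ ω ∂P, ∀ p q : Fin d × ℕ, p.1 ≠ q.1 →
      ringTime (fun i n => τ i n ω) p ≠ ringTime (fun i n => τ i n ω) q := by
    refine ae_all_iff.2 fun p => ae_all_iff.2 fun q => ?_
    by_cases hpq : p.1 = q.1
    · exact Eventually.of_forall fun _ h => absurd hpq h
    · have := measure_eq_zero_iff_ae_notMem.1 (measure_ringTime_eq hm hlaw hind hpq)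
      filter_upwards [this] with ω hω _ using hω
  filter_upwards [hne, ae_pos_of_hasLaw_exp hlaw, ae_tendsto_sum_of_hasLaw_exp hm hlaw hind]
    with ω h1 h2 h3
  have hmono : ∀ i, StrictMono fun n => ringTime (fun i n => τ i n ω) (i, n) := by
    intro i
    refine strictMono_nat_of_lt_succ fun n => ?_
    simp only [ringTime]
    rw [Finset.sum_range_succ _ (n + 1)]
    exact lt_add_of_pos_right _ (h2 i (n + 1))
  refine ⟨fun p => Finset.sum_pos (fun k _ => h2 _ _) (by simp), fun p q hpq => ?_,
    fun i => (hmono i).monotone, fun i => (h3 i).comp (tendsto_add_atTop_nat 1)⟩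
  have h4 : p.1 = q.1 := by
    by_contra hcon
    exact h1 p q hcon hpq
  obtain ⟨i, n⟩ := p
  obtain ⟨j, m⟩ := q
  obtain rfl : i = j := h4
  rw [(hmono i).injective hpq]

end Clocks

/-! ## Coins from geometric waiting times -/

/-- A word `b` of length `n` is encoded by its `k` gaps `m` between successes and its `r` trailing
failures. A renewal sequence produces the word exactly when its first `k` gaps are these and the
next one exceeds `r`. The last identity matches the geometric weights of the gaps with the coin
weights of the letters. -/
theorem cylinder_renewal {K : Type*} [CommSemiring K] (e f : K) (b : ℕ → Bool) (n : ℕ) :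
    ∃ (k r : ℕ) (m : ℕ → ℕ), (∀ j < k, 1 ≤ m j) ∧ (∑ j ∈ Finset.range k, m j) + r = n ∧
      (∀ g : ℕ → ℕ, (∀ j, 0 < g j) →
        ((∀ s < n, ((∃ q, ∑ j ∈ Finset.range (q + 1), g j = s + 1) ↔ b s = true)) ↔
          (∀ j < k, g j = m j) ∧ r < g k)) ∧
      (∏ j ∈ Finset.range k, e ^ (m j - 1) * f) * e ^ r
        = ∏ s ∈ Finset.range n, if b s = true then f else e := by
  induction n with
  | zero => exact ⟨0, 0, fun _ => 0, by simp, by simp, fun g hg => by simp [hg], by simp⟩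
  | succ n ih =>
    obtain ⟨k, r, m, hm, hsum, hiff, hprod⟩ := ih
    -- The first `k` gaps sum to `n - r` and the next exceeds `r`, so only the partial sum of `k +
    -- 1` gaps can equal `n + 1`.
    have hlast : ∀ g : ℕ → ℕ, (∀ j, 0 < g j) → (∀ j < k, g j = m j) → r < g k →
        ((∃ q, ∑ j ∈ Finset.range (q + 1), g j = n + 1) ↔ g k = r + 1) := by
      intro g hg h1 h2
      have hk : ∑ j ∈ Finset.range k, g j = ∑ j ∈ Finset.range k, m j :=
        Finset.sum_congr rfl fun j hj => h1 j (Finset.mem_range.1 hj)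
      have hk1 : ∑ j ∈ Finset.range (k + 1), g j = ∑ j ∈ Finset.range k, m j + g k := by
        rw [Finset.sum_range_succ, hk]
      have hmono : StrictMono fun q => ∑ j ∈ Finset.range q, g j :=
        strictMono_nat_of_lt_succ fun q => by
          rw [Finset.sum_range_succ]
          exact Nat.lt_add_of_pos_right (hg q)
      constructor
      · rintro ⟨q, hq⟩
        have h3 : k < q + 1 := hmono.lt_iff_lt.1 (by simp only [hk, hq]; omega)
        have h4 : q + 1 ≤ k + 1 := hmono.le_iff_le.1 (by simp only [hk1, hq]; omega)
        obtain rfl : q = k := by omega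
        omega
      · intro h
        exact ⟨k, by omega⟩
    cases hb : b n with
    | true =>
      -- A success closes the current run of `r` failures into a gap of length `r + 1`.
      refine ⟨k + 1, 0, Function.update m k (r + 1), fun j hj => ?_, ?_, fun g hg => ?_, ?_⟩
      · rcases Nat.lt_succ_iff_lt_or_eq.1 hj with h | rfl
        · rw [Function.update_of_ne h.ne]
          exact hm j h
        · simp
      · rw [Finset.sum_range_succ, Finset.sum_update_of_notMem (by simp), Function.update_self]
        omega
      · simp only [Nat.lt_succ_iff_lt_or_eq, or_imp, forall_and, forall_eq, hiff g hg, hb, iff_true,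
          Function.update_self, hg, and_true]
        have h5 : (∀ j < k, g j = Function.update m k (r + 1) j) ↔ ∀ j < k, g j = m j :=
          forall₂_congr fun j hj => by rw [Function.update_of_ne hj.ne]
        rw [h5]
        constructor
        · rintro ⟨⟨h1, h2⟩, h3⟩
          exact ⟨h1, (hlast g hg h1 h2).1 h3⟩
        · rintro ⟨h1, h2⟩
          exact ⟨⟨h1, by omega⟩, (hlast g hg h1 (by omega)).2 h2⟩
      · rw [Finset.prod_range_succ, Finset.prod_range_succ, ← hprod, if_pos hb,
          Finset.prod_congr rfl fun j hj => by
            rw [Function.update_of_ne (Finset.mem_range.1 hj).ne]]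
        simp only [Function.update_self, Nat.add_sub_cancel]
        ring
    | false =>
      refine ⟨k, r + 1, m, hm, by omega, fun g hg => ?_, ?_⟩
      · simp only [Nat.lt_succ_iff_lt_or_eq, or_imp, forall_and, forall_eq, hiff g hg, hb,
          Bool.false_eq_true, iff_false]
        constructor
        · rintro ⟨⟨h1, h2⟩, h3⟩
          rw [hlast g hg h1 h2] at h3
          exact ⟨h1, by omega⟩
        · rintro ⟨h1, h2⟩
          rw [hlast g hg h1 (by omega)]
          exact ⟨⟨h1, by omega⟩, by omega⟩
      · rw [Finset.prod_range_succ, ← hprod, hb, if_neg (by simp)]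
        ring

/-- The coins whose successes are separated by the waiting times `G`. -/
noncomputable def renewalCoins {d : ℕ} (G : Fin d → ℕ → ℕ) (s : ℕ) (i : Fin d) : Bool :=
  open Classical in decide (∃ n, ∑ k ∈ Finset.range (n + 1), G i k = s + 1)

theorem renewalCoins_eq_true_iff {d : ℕ} (G : Fin d → ℕ → ℕ) (s : ℕ) (i : Fin d) :
    renewalCoins G s i = true ↔ ∃ n, ∑ k ∈ Finset.range (n + 1), G i k = s + 1 := by
  simp [renewalCoins]

theorem measure_eq_succ_of_geometric {Ω : Type*} [MeasurableSpace Ω] {P : Measure Ω}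
    [IsProbabilityMeasure P] {ε : ℝ} (hε : ε ∈ Set.Ioo (0 : ℝ) 1) {G : Ω → ℕ} (hG : Measurable G)
    (hgeo : ∀ r, P {ω | r < G ω} = ENNReal.ofReal ε ^ r) (r : ℕ) :
    P {ω | G ω = r + 1} = ENNReal.ofReal ε ^ r * ENNReal.ofReal (1 - ε) := by
  have h1 : {ω | G ω = r + 1} = {ω | r < G ω} \ {ω | r + 1 < G ω} := by
    ext ω
    simp only [Set.mem_ofPred_eq, Set.mem_sdiff]
    omega
  have hms : MeasurableSet {ω | r + 1 < G ω} := measurableSet_lt measurable_const hG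
  have hsub : {ω | r + 1 < G ω} ⊆ {ω | r < G ω} := fun ω hω => (Nat.lt_succ_self r).trans hω
  rw [h1, measure_sdiff hsub hms.nullMeasurableSet
    (measure_ne_top _ _), hgeo, hgeo, ← ENNReal.ofReal_pow hε.1.le, ← ENNReal.ofReal_pow hε.1.le,
    ← ENNReal.ofReal_sub _ (pow_nonneg hε.1.le _), ← ENNReal.ofReal_mul (pow_nonneg hε.1.le _)]
  congr 1
  ring

theorem measure_cylinder_renewalCoins {Ω : Type*} [MeasurableSpace Ω] {P : Measure Ω}
    [IsProbabilityMeasure P] {d : ℕ} {ε : ℝ} (hε : ε ∈ Set.Ioo (0 : ℝ) 1)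
    {G : Fin d → ℕ → Ω → ℕ} (hG : ∀ i n, Measurable (G i n))
    (hind : iIndepFun (fun p : Fin d × ℕ => G p.1 p.2) P)
    (hgeo : ∀ i n r, P {ω | r < G i n ω} = ENNReal.ofReal ε ^ r) (n : ℕ) (b : ℕ → Fin d → Bool) :
    P {ω | ∀ s < n, ∀ i, renewalCoins (fun i k => G i k ω) s i = b s i} =
      ∏ i, ∏ s ∈ Finset.range n,
        if b s i = true then ENNReal.ofReal (1 - ε) else ENNReal.ofReal ε := by
  choose k r m hm _ hiff hprod using fun i : Fin d =>
    cylinder_renewal (ENNReal.ofReal ε) (ENNReal.ofReal (1 - ε)) (fun s => b s i) n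
  -- The case `r = 0` of the geometric tail excludes zero gaps, which `cylinder_renewal` does not
  -- allow.
  have hpos : ∀ᵐ ω ∂P, ∀ i j, 0 < G i j ω := by
    refine ae_all_iff.2 fun i => ae_all_iff.2 fun j => ?_
    have h := hgeo i j 0
    rw [pow_zero] at h
    exact (prob_compl_eq_zero_iff (measurableSet_lt measurable_const (hG i j))).2 h
  -- A sigma type, because the number of gaps that matter depends on the ball.
  set S : Finset (Σ _ : Fin d, ℕ) := Finset.univ.sigma fun i => Finset.range (k i + 1) with hS
  set sets : (Σ _ : Fin d, ℕ) → Set ℕ := fun q =>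
    if q.2 < k q.1 then {m q.1 q.2} else Set.Ioi (r q.1) with hsets
  have hset : {ω | ∀ s < n, ∀ i, renewalCoins (fun i k => G i k ω) s i = b s i} =ᵐ[P]
      ⋂ q ∈ S, (G q.1 q.2) ⁻¹' sets q := by
    filter_upwards [hpos] with ω hω
    apply propext
    change (∀ s < n, ∀ i, renewalCoins (fun i k => G i k ω) s i = b s i) ↔
      ω ∈ ⋂ q ∈ S, (G q.1 q.2) ⁻¹' sets q
    have h1 : (∀ s < n, ∀ i, renewalCoins (fun i k => G i k ω) s i = b s i) ↔
        ∀ i, (∀ j < k i, G i j ω = m i j) ∧ r i < G i (k i) ω := by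
      simp only [← hiff _ (fun j => G _ j ω) (hω _)]
      have hb : ∀ s i, renewalCoins (fun i k => G i k ω) s i = b s i ↔
          ((∃ q, ∑ j ∈ Finset.range (q + 1), G i j ω = s + 1) ↔ b s i = true) := by
        intro s i
        rw [Bool.eq_iff_iff, renewalCoins_eq_true_iff]
      simp only [hb]
      exact ⟨fun h i s hs => h s hs i, fun h s hs i => h i s hs⟩
    rw [h1]
    simp only [Set.mem_iInter, hS, Finset.mem_sigma, Finset.mem_univ, true_and, Finset.mem_range,
      Set.mem_preimage, Sigma.forall]
    refine forall_congr' fun i => ⟨fun h j hj => ?_, fun h => ⟨fun j hj => ?_, ?_⟩⟩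
    · simp only [hsets]
      split_ifs with hjk
      · exact h.1 j hjk
      · obtain rfl : j = k i := by omega
        exact h.2
    · have := h j (by omega)
      simpa [hsets, hj] using this
    · have := h (k i) (by omega)
      simpa [hsets] using this
  rw [measure_congr hset]
  have hind' : iIndepFun (fun q : Σ _ : Fin d, ℕ => G q.1 q.2) P :=
    hind.precomp (g := fun q : Σ _ : Fin d, ℕ => (q.1, q.2)) (Equiv.sigmaEquivProd _ _).injective
  rw [hind'.measure_inter_preimage_eq_mul S fun q _ => MeasurableSet.of_discrete, hS,
    Finset.prod_sigma]
  refine Finset.prod_congr rfl fun i _ => ?_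
  rw [← hprod i, Finset.prod_range_succ]
  congr 1
  · refine Finset.prod_congr rfl fun j hj => ?_
    have hj' := Finset.mem_range.1 hj
    obtain ⟨u, hu⟩ : ∃ u, m i j = u + 1 := ⟨m i j - 1, by have := hm i j hj'; omega⟩
    rw [hu, Nat.add_sub_cancel, ← measure_eq_succ_of_geometric hε (hG i j) (hgeo i j)]
    congr 1
    ext ω
    simp [hsets, hj', hu]
  · rw [← hgeo i (k i)]
    congr 1
    ext ω
    simp [hsets]

theorem measure_cylinder_coins {Ω : Type*} [MeasurableSpace Ω] {P : Measure Ω} {d : ℕ} {ε : ℝ}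
    {coin : ℕ → Fin d → Ω → Bool} (h : IsSBBSCoins P d ε coin) (n : ℕ) (b : ℕ → Fin d → Bool) :
    P {ω | ∀ s < n, ∀ i, coin s i ω = b s i} =
      ∏ i, ∏ s ∈ Finset.range n,
        if b s i = true then ENNReal.ofReal (1 - ε) else ENNReal.ofReal ε := by
  have h1 : {ω | ∀ s < n, ∀ i, coin s i ω = b s i} =
      ⋂ p ∈ Finset.range n ×ˢ (Finset.univ : Finset (Fin d)), coin p.1 p.2 ⁻¹' {b p.1 p.2} := by
    ext ω
    simp only [Set.mem_ofPred_eq, Finset.mem_product, Finset.mem_range, Finset.mem_univ, and_true,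
      Set.mem_iInter, Set.mem_preimage, Set.mem_singleton_iff, Prod.forall]
    exact ⟨fun h s i hs => h s hs i, fun h s hs i => h s i hs⟩
  rw [h1, h.indep.measure_inter_preimage_eq_mul _ fun _ _ => MeasurableSet.of_discrete,
    Finset.prod_product_right]
  refine Finset.prod_congr rfl fun i _ => Finset.prod_congr rfl fun s _ => ?_
  split_ifs with hb
  · rw [hb]
    exact h.success s i
  · rw [Bool.not_eq_true] at hb
    rw [hb]
    exact h.failure s i

/-- The laws of the initial segments determine the law of the sequence, as the unique projective
limit; for countable `A` they are determined by their values at single words. -/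
theorem map_eq_of_cylinders {Ω Ω' A : Type*} [MeasurableSpace Ω] [MeasurableSpace Ω']
    [MeasurableSpace A] [MeasurableSingletonClass A] [Countable A] [Nonempty A]
    {P : Measure Ω} {P' : Measure Ω'} [IsProbabilityMeasure P]
    {Y : Ω → ℕ → A} {Y' : Ω' → ℕ → A} (hY : Measurable Y) (hY' : Measurable Y')
    (h : ∀ n (b : ℕ → A), P {ω | ∀ s < n, Y ω s = b s} = P' {ω | ∀ s < n, Y' ω s = b s}) :
    P.map Y = P'.map Y' := by
  let Q : (I : Finset ℕ) → Measure (I → A) := fun I => (P.map Y).map I.restrict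
  have hprob : IsProbabilityMeasure (P.map Y) := Measure.isProbabilityMeasure_map hY.aemeasurable
  have hfin : ∀ I, IsFiniteMeasure (Q I) := fun I => by
    dsimp only [Q]
    infer_instance
  have hQ : IsProjectiveMeasureFamily (α := fun _ => A) Q := by
    intro I J hJI
    dsimp only [Q]
    rw [Measure.map_map (Finset.measurable_restrict₂ hJI) (Finset.measurable_restrict I),
      Finset.restrict₂_comp_restrict]
  refine IsProjectiveLimit.unique (α := fun _ => A) (P := Q) (fun I => rfl)
    ((isProjectiveLimit_nat_iff (X := fun _ => A) hQ _).2 fun n => ?_)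
  dsimp only [Q]
  refine Measure.ext_of_singleton fun a => ?_
  classical
  let b : ℕ → A := fun s => if hs : s ∈ Finset.Iic n then a ⟨s, hs⟩ else Classical.arbitrary A
  have hpre : (Preorder.frestrictLe (π := fun _ : ℕ => A) n) ⁻¹' {a} =
      {y : ℕ → A | ∀ s < n + 1, y s = b s} := by
    ext y
    simp only [Set.mem_preimage, Set.mem_singleton_iff, Set.mem_ofPred_eq, funext_iff,
      Preorder.frestrictLe_apply, Subtype.forall, Finset.mem_Iic, Nat.lt_succ_iff]
    refine forall₂_congr fun s hs => ?_
    simp [b, hs]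
  change _ = ((P.map Y).map (Preorder.frestrictLe (π := fun _ : ℕ => A) n)) {a}
  have hms : MeasurableSet {y : ℕ → A | ∀ s < n + 1, y s = b s} := by
    rw [← hpre]
    exact Preorder.measurable_frestrictLe n (measurableSet_singleton a)
  rw [Measure.map_apply (Preorder.measurable_frestrictLe n) (measurableSet_singleton a),
    Measure.map_apply (Preorder.measurable_frestrictLe n) (measurableSet_singleton a), hpre,
    Measure.map_apply hY hms, Measure.map_apply hY' hms]
  exact (h (n + 1) b).symm

/-! ## Coupling with exponential clocks -/

/-- With `u = -log ε`, the expression is `u * ⌈x / u⌉` times `(1 - ε) / u`. The first factor tends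
to `x` as `u` decreases to 0, the second to 1 by the derivative of `log` at 1. -/
theorem tendsto_rescaled_ceil {x : ℝ} (hx : 0 ≤ x) :
    Tendsto (fun ε : ℝ => (1 - ε) * (⌈x / -Real.log ε⌉₊ : ℝ)) (𝓝[<] 1) (𝓝 x) := by
  have hlog : Tendsto (fun ε : ℝ => -Real.log ε) (𝓝[<] 1) (𝓝[>] 0) := by
    refine tendsto_nhdsWithin_iff.2 ⟨?_, ?_⟩
    · have h : Tendsto (fun ε : ℝ => -Real.log ε) (𝓝 1) (𝓝 (-Real.log 1)) :=
        (Real.continuousAt_log one_ne_zero).tendsto.neg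
      rw [Real.log_one, neg_zero] at h
      exact h.mono_left nhdsWithin_le_nhds
    · filter_upwards [Ioo_mem_nhdsLT zero_lt_one] with ε hε
      exact neg_pos.2 (Real.log_neg hε.1 hε.2)
  have h1 : Tendsto (fun ε : ℝ => (⌈x * (-Real.log ε)⁻¹⌉₊ : ℝ) / (-Real.log ε)⁻¹) (𝓝[<] 1) (𝓝 x) :=
    (tendsto_nat_ceil_mul_div_atTop hx).comp (tendsto_inv_nhdsGT_zero.comp hlog)
  have h2 : Tendsto (fun ε : ℝ => Real.log ε / (ε - 1)) (𝓝[<] 1) (𝓝 1) := by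
    have h := (hasDerivAt_iff_tendsto_slope.1 (Real.hasDerivAt_log one_ne_zero)).mono_left
      (nhdsWithin_mono 1 fun ε (hε : ε < 1) => hε.ne)
    rw [inv_one] at h
    refine h.congr fun ε => ?_
    rw [slope_def_field, Real.log_one, sub_zero]
  have h3 := h1.mul (h2.inv₀ one_ne_zero)
  rw [inv_one, mul_one] at h3
  refine h3.congr' ?_
  filter_upwards [Ioo_mem_nhdsLT zero_lt_one] with ε hε
  have hne : Real.log ε ≠ 0 := (Real.log_neg hε.1 hε.2).ne
  have hne' : ε - 1 ≠ 0 := by linarith [hε.2]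
  rw [div_eq_mul_inv x]
  field_simp
  ring

/-- The waiting times `τ` in units of `-log ε`, rounded up. -/
noncomputable def geometricTime {d : ℕ} (ε : ℝ) (τ : Fin d → ℕ → ℝ) (i : Fin d) (n : ℕ) : ℕ :=
  ⌈τ i n / -Real.log ε⌉₊

theorem measurable_geometricTime {Ω : Type*} [MeasurableSpace Ω] {d : ℕ} (ε : ℝ)
    {τ : Fin d → ℕ → Ω → ℝ} (hm : ∀ i n, Measurable (τ i n)) (i : Fin d) (n : ℕ) :
    Measurable fun ω => geometricTime ε (fun i n => τ i n ω) i n :=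
  Nat.measurable_ceil.comp ((hm i n).div_const _)

/-- The unit `-log ε` is chosen so that the exponential tail at `r` units is exactly `ε ^ r`. -/
theorem measure_lt_geometricTime {Ω : Type*} [MeasurableSpace Ω] {P : Measure Ω} {d : ℕ}
    {ε : ℝ} (hε : ε ∈ Set.Ioo (0 : ℝ) 1) {τ : Fin d → ℕ → Ω → ℝ}
    (hlaw : ∀ i n, HasLaw (τ i n) (expMeasure 1) P) (i : Fin d) (n r : ℕ) :
    P {ω | r < geometricTime ε (fun i n => τ i n ω) i n} = ENNReal.ofReal ε ^ r := by
  have hlog : 0 < -Real.log ε := neg_pos.2 (Real.log_neg hε.1 hε.2)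
  have h1 : {ω | r < geometricTime ε (fun i n => τ i n ω) i n} =
      {ω | r * -Real.log ε < τ i n ω} := by
    ext ω
    simp only [Set.mem_ofPred_eq, geometricTime, Nat.lt_ceil, lt_div_iff₀ hlog]
  rw [h1, measure_lt_of_hasLaw_exp (hlaw i n) (by positivity), ← ENNReal.ofReal_pow hε.1.le]
  congr 1
  rw [mul_neg, neg_neg, Real.exp_nat_mul, Real.exp_log hε.1]

theorem iIndepFun_geometricTime {Ω : Type*} [MeasurableSpace Ω] {P : Measure Ω} {d : ℕ} (ε : ℝ)
    {τ : Fin d → ℕ → Ω → ℝ} (hind : iIndepFun (fun p : Fin d × ℕ => τ p.1 p.2) P) :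
    iIndepFun (fun (p : Fin d × ℕ) ω => geometricTime ε (fun i n => τ i n ω) p.1 p.2) P :=
  hind.comp (fun _ x => ⌈x / -Real.log ε⌉₊) fun _ =>
    Nat.measurable_ceil.comp (measurable_id.div_const _)

theorem measurable_renewalCoins {Ω : Type*} [MeasurableSpace Ω] {d : ℕ} {G : Fin d → ℕ → Ω → ℕ}
    (hG : ∀ i n, Measurable (G i n)) :
    Measurable fun ω => renewalCoins fun i n => G i n ω := by
  refine measurable_pi_lambda _ fun s => measurable_pi_lambda _ fun i => ?_
  refine measurable_to_bool ?_
  have : (fun ω => renewalCoins (fun i n => G i n ω) s i) ⁻¹' {true} =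
      ⋃ n, {ω | ∑ k ∈ Finset.range (n + 1), G i k ω = s + 1} := by
    ext ω
    simp [renewalCoins_eq_true_iff]
  rw [this]
  exact MeasurableSet.iUnion fun n =>
    measurableSet_eq_fun (Finset.measurable_fun_sum _ fun k _ => hG i k) measurable_const

/-- The box-ball coins built from exponential waiting times have the law of the coins of a
stochastic box-ball system. -/
theorem map_coins_eq_map_renewalCoins {Ω Ω' : Type*} [MeasurableSpace Ω] [MeasurableSpace Ω']
    {P : Measure Ω} [IsProbabilityMeasure P] {P' : Measure Ω'} [IsProbabilityMeasure P'] {d : ℕ}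
    {ε : ℝ} (hε : ε ∈ Set.Ioo (0 : ℝ) 1) {coin : ℕ → Fin d → Ω → Bool}
    (hcoin : IsSBBSCoins P d ε coin) {τ : Fin d → ℕ → Ω' → ℝ} (hm : ∀ i n, Measurable (τ i n))
    (hlaw : ∀ i n, HasLaw (τ i n) (expMeasure 1) P')
    (hind : iIndepFun (fun p : Fin d × ℕ => τ p.1 p.2) P') :
    P.map (fun ω s i => coin s i ω) =
      P'.map fun ω => renewalCoins (geometricTime ε fun i n => τ i n ω) := by
  refine map_eq_of_cylinders
    (measurable_pi_lambda _ fun s => measurable_pi_lambda _ fun i => hcoin.measurable s i)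
    (measurable_renewalCoins fun i n => measurable_geometricTime ε hm i n) fun n b => ?_
  simp only [funext_iff]
  rw [measure_cylinder_coins hcoin,
    ← measure_cylinder_renewalCoins hε (fun i n => measurable_geometricTime ε hm i n)
      (iIndepFun_geometricTime ε hind) (measure_lt_geometricTime hε hlaw)]

/-- The pathwise form of the theorem, for one fixed realisation of the clocks. -/
theorem tendsto_sbbsPath {d : ℕ} {c : ℕ∞} (hc : 1 ≤ c) {x₀ : Fin d → ℕ} (hx₀ : StrictMono x₀)
    {τ : Fin d → ℕ → ℝ} (hτ : ∀ i n, 0 ≤ τ i n) (hR : IsProperRinging (ringTime τ))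
    {x : CadlagPath (Fin d → ℕ)} (hx : IsDrivenBy x₀ (ringTime τ) x) :
    Tendsto (fun ε : Set.Ioo (0 : ℝ) 1 => floorPath ε fun n =>
        ballPositions d (sbbs c x₀ (renewalCoins (geometricTime ε τ)) n))
      (comap ((↑) : Set.Ioo (0 : ℝ) 1 → ℝ) (𝓝[<] 1)) (𝓝 x) := by
  refine tendsto_of_isDrivenBy (x₀ := x₀) hR
    (R' := fun (ε : Set.Ioo (0 : ℝ) 1) p =>
      (1 - (ε : ℝ)) * ((∑ k ∈ Finset.range (p.2 + 1), geometricTime ε τ p.1 k : ℕ) : ℝ))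
    (Eventually.of_forall fun ε i n m hnm => ?_) (fun p => ?_) hx
    (Eventually.of_forall fun ε => isDrivenBy_sbbs hc hx₀ (fun s i => ?_) ε)
  · have hb : 0 ≤ 1 - (ε : ℝ) := by linarith [ε.2.2]
    refine mul_le_mul_of_nonneg_left (Nat.cast_le.2 ?_) hb
    exact Finset.sum_le_sum_of_subset (Finset.range_subset_range.2 (by omega))
  · simp only [Nat.cast_sum, Finset.mul_sum]
    exact tendsto_finsetSum _ fun k _ => (tendsto_rescaled_ceil (hτ p.1 k)).comp tendsto_comap
  · exact renewalCoins_eq_true_iff _ s i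

/-- The waiting times of the clocks of a PushTASEP can be taken measurable. -/
theorem IsPushTASEP.exists_measurable {Ω : Type*} [MeasurableSpace Ω] {P : Measure Ω} {d : ℕ}
    {x₀ : Fin d → ℕ} {X : Ω → CadlagPath (Fin d → ℕ)} (hX : IsPushTASEP P x₀ X) :
    ∃ τ : Fin d → ℕ → Ω → ℝ, (∀ i n, Measurable (τ i n)) ∧
      (∀ i n, HasLaw (τ i n) (expMeasure 1) P) ∧
      iIndepFun (fun p : Fin d × ℕ => τ p.1 p.2) P ∧
      ∀ᵐ ω ∂P, IsDrivenBy x₀ (ringTime fun i n => τ i n ω) (X ω) := by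
  obtain ⟨τ, hlaw, hind, h⟩ := hX
  have hae : ∀ i n, τ i n =ᵐ[P] (hlaw i n).aemeasurable.mk (τ i n) := fun i n =>
    (hlaw i n).aemeasurable.ae_eq_mk
  refine ⟨fun i n => (hlaw i n).aemeasurable.mk (τ i n),
    fun i n => (hlaw i n).aemeasurable.measurable_mk, fun i n => (hlaw i n).congr (hae i n).symm,
    hind.congr fun p => hae p.1 p.2, ?_⟩
  filter_upwards [h, ae_all_iff.2 fun i => ae_all_iff.2 fun n => hae i n] with ω hω heq
  have h1 : (fun i n => (hlaw i n).aemeasurable.mk (τ i n) ω) = fun i n => τ i n ω := by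
    funext i n
    exact (heq i n).symm
  rw [h1]
  exact isDrivenBy_of_pushTASEP (X ω) hω.1 hω.2

theorem theorem2p1 (d : ℕ) (c : ℕ∞) (hc : 1 ≤ c) (x₀ : Fin d → ℕ) (hx₀ : StrictMono x₀)
    {Ω : Set.Ioo (0 : ℝ) 1 → Type*} [∀ ε, MeasurableSpace (Ω ε)]
    (P : ∀ ε, Measure (Ω ε)) [∀ ε, IsProbabilityMeasure (P ε)]
    (coin : ∀ ε, ℕ → Fin d → Ω ε → Bool) (hcoin : ∀ ε, IsSBBSCoins (P ε) d ε (coin ε))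
    {Ω' : Type*} [MeasurableSpace Ω'] (P' : Measure Ω') [IsProbabilityMeasure P']
    (X : Ω' → CadlagPath (Fin d → ℕ)) (hX : IsPushTASEP P' x₀ X) :
    TendstoInDistribution (fun ε => sbbsProcess c x₀ ε (coin ε))
      (comap ((↑) : Set.Ioo (0 : ℝ) 1 → ℝ) (𝓝[<] 1)) X P P' := by
  obtain ⟨τ, hm, hlaw, hind, hdriven⟩ := hX.exists_measurable
  have hproper := ae_isProperRinging hm hlaw hind
  have hRm : Measurable fun ω => ringTime fun i n => τ i n ω :=
    measurable_pi_lambda _ fun p => Finset.measurable_fun_sum _ fun k _ => hm p.1 k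
  have hXm : AEMeasurable X P' := aemeasurable_of_isDrivenBy hRm (hproper.and hdriven)
  have hcm : ∀ ε, Measurable fun ω s i => coin ε s i ω := fun ε =>
    measurable_pi_lambda _ fun s => measurable_pi_lambda _ fun i => (hcoin ε).measurable s i
  have hcm' : ∀ ε : Set.Ioo (0 : ℝ) 1,
      Measurable fun ω => renewalCoins (geometricTime ε fun i n => τ i n ω) := fun ε =>
    measurable_renewalCoins fun i n => measurable_geometricTime ε hm i n
  have hYm : ∀ ε, Measurable (sbbsProcess c x₀ ε (coin ε)) := fun ε =>
    (measurable_sbbsPath c x₀ ε).comp (hcm ε)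
  refine ⟨fun ε => (hYm ε).aemeasurable, hXm, ?_⟩
  refine ProbabilityMeasure.tendsto_iff_forall_integral_tendsto.2 fun f => ?_
  change Tendsto (fun ε => ∫ y, f y ∂((P ε).map (sbbsProcess c x₀ ε (coin ε)))) _
    (𝓝 (∫ y, f y ∂(P'.map X)))
  have hfm : Measurable f := f.continuous.measurable
  -- The path is a measurable function of the coins, so equality in law of the coins moves every
  -- expectation to the space of the PushTASEP.
  have hcoupled : ∀ ε : Set.Ioo (0 : ℝ) 1,
      ∫ y, f y ∂((P ε).map (sbbsProcess c x₀ ε (coin ε))) =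
        ∫ ω, f (floorPath ε fun n => ballPositions d
          (sbbs c x₀ (renewalCoins (geometricTime ε fun i n => τ i n ω)) n)) ∂P' := by
    intro ε
    have h1 : (P ε).map (sbbsProcess c x₀ ε (coin ε)) =
        P'.map ((fun a => floorPath ε fun n => ballPositions d (sbbs c x₀ a n)) ∘
          fun ω => renewalCoins (geometricTime ε fun i n => τ i n ω)) := by
      rw [← Measure.map_map (measurable_sbbsPath c x₀ ε) (hcm' ε),
        ← map_coins_eq_map_renewalCoins ε.2 (hcoin ε) hm hlaw hind,
        Measure.map_map (measurable_sbbsPath c x₀ ε) (hcm ε)]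
      rfl
    rw [h1, integral_map ((measurable_sbbsPath c x₀ ε).comp (hcm' ε)).aemeasurable
      hfm.aestronglyMeasurable]
    rfl
  simp_rw [hcoupled]
  rw [integral_map hXm hfm.aestronglyMeasurable]
  refine tendsto_integral_filter_of_dominated_convergence (fun _ => ‖f‖) ?_ ?_
    (integrable_const _) ?_
  · exact Eventually.of_forall fun ε =>
      (hfm.comp ((measurable_sbbsPath c x₀ ε).comp (hcm' ε))).aestronglyMeasurable
  · exact Eventually.of_forall fun ε => Eventually.of_forall fun ω => f.norm_coe_le_norm _
  · filter_upwards [hproper, hdriven, ae_pos_of_hasLaw_exp hlaw] with ω h1 h2 h3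
    exact (f.continuous.tendsto _).comp
      (tendsto_sbbsPath hc hx₀ (fun i n => (h3 i n).le) h1 h2)
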